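/- For $\alpha\in\mathbb D=\{z\in\mathbb C:|z|<1\}$ and $\lambda\in\partial\mathbb D$ let $$\Theta(\alpha,\lambda)=\lambda\begin{bmatrix}\overline\alpha&\rho\\ \rho&-\alpha\end{bmatrix},\qquad \rho=\sqrt{1-|\alpha|^2}.$$ For a sequence $(\alpha_n,\lambda_n)_{n\in\mathbb Z}\in(\mathbb D\times\partial\mathbb D)^{\mathbb Z}$, the phased CMV (pCMV) operator on $\ell^2(\mathbb Z)$ is $\mathcal E_{\alpha,\lambda}=\mathcal L\mathcal M$, where $\mathcal L=\bigoplus_{j\in\mathbb Z}\Theta(\alpha_{2j},\lambda_{2j})$ and $\mathcal M=\bigoplus_{j\in\mathbb Z}\Theta(\alpha_{2j+1},\lambda_{2j+1})$, with $\Theta(\alpha_k,\lambda_k)$ acting on $\ell^2(\{k,k+1\})$. For an integer $q\ge 1$ and $r\in(0,1)$, let $\mathcal P(q,r)$ be the set of all operators $\mathcal E_{\alpha,\lambda}$ with $\alpha_{n+q}=\alpha_n$ and $\lambda_{n+q}=\lambda_n$ for all $n\in\mathbb Z$ and $\|\alpha\|_\infty\le r$. **Lemma.** Let $q$ be a positive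 even integer, $r\in(0,1)$, $\mathcal E\in\mathcal P(q,r)$ and $\delta>0$. Then there exist constants $c>0$ and $N_0>0$ such that for every integer $n\ge N_0$ there is an operator $\mathcal E'\in\mathcal P(nq,r)$ with $$\|\mathcal E-\mathcal E'\|<\delta\qquad\text{and}\qquad \mathrm{Leb}(\sigma(\mathcal E'))\le e^{-cnq},$$ where $\|\cdot\|$ is the operator norm, $\sigma(\mathcal E')\subseteq\partial\mathbb D$ is the spectrum of $\mathcal E'$, and $\mathrm{Leb}$ is arc length measure on $\partial\mathbb D$ (of total mass $2\pi$). -/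

import Mathlib

open MeasureTheory
open scoped ComplexConjugate

noncomputable section

namespace PCMV

/-- The Hilbert space `ℓ²(ℤ)` of square-summable complex sequences indexed by `ℤ`. -/
abbrev Ell2 : Type := lp (fun _ : ℤ => ℂ) 2

/-- The `2 × 2` unitary matrix `Θ(α, lam) = lam * [[conj α, ρ], [ρ, -α]]`, `ρ = √(1 - |α|²)`. -/
def theta (α : Complex.UnitDisc) (lam : Circle) : Matrix (Fin 2) (Fin 2) ℂ :=
  (lam : ℂ) • !![conj (α : ℂ), ((Real.sqrt (1 - ‖(α : ℂ)‖ ^ 2) : ℝ) : ℂ);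
                 ((Real.sqrt (1 - ‖(α : ℂ)‖ ^ 2) : ℝ) : ℂ), -(α : ℂ)]

theorem norm_theta_le_one (α : Complex.UnitDisc) (lam : Circle) (i j : Fin 2) :
    ‖theta α lam i j‖ ≤ 1 := by
  have h1 : ‖(α : ℂ)‖ ≤ 1 := α.norm_lt_one.le
  have h2 : Real.sqrt (1 - ‖(α : ℂ)‖ ^ 2) ≤ 1 := by
    refine Real.sqrt_le_one.2 ?_
    nlinarith [norm_nonneg (α : ℂ)]
  have h3 : ‖(lam : ℂ)‖ = 1 := Circle.norm_coe lam
  fin_cases i <;> fin_cases j <;>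
    simp [theta, abs_of_nonneg (Real.sqrt_nonneg _), h1, h2, h3]

/-- The action on sequences of the direct sum of the blocks `Θ(α k, lam k)` over all `k ≡ p mod 2`,
the block with index `k` acting on the coordinates `k` and `k + 1`. -/
def blockFun (p : ℤ) (α : ℤ → Complex.UnitDisc) (lam : ℤ → Circle) (ψ : ℤ → ℂ) (n : ℤ) : ℂ :=
  if Even (n - p) then
    theta (α n) (lam n) 0 0 * ψ n + theta (α n) (lam n) 0 1 * ψ (n + 1)
  else
    theta (α (n - 1)) (lam (n - 1)) 1 0 * ψ (n - 1) + theta (α (n - 1)) (lam (n - 1)) 1 1 * ψ n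

theorem norm_blockFun_le (p : ℤ) (α : ℤ → Complex.UnitDisc) (lam : ℤ → Circle) (ψ : ℤ → ℂ)
    (n : ℤ) : ‖blockFun p α lam ψ n‖ ≤ ‖ψ n‖ + ‖ψ (n + 1)‖ + ‖ψ (n - 1)‖ := by
  have key : ∀ (a b x y : ℂ), ‖a‖ ≤ 1 → ‖b‖ ≤ 1 → ‖a * x + b * y‖ ≤ ‖x‖ + ‖y‖ := by
    intro a b x y ha hb
    refine (norm_add_le _ _).trans ?_
    rw [norm_mul, norm_mul]
    nlinarith [norm_nonneg x, norm_nonneg y]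
  unfold blockFun
  split_ifs
  · have := key _ _ (ψ n) (ψ (n + 1)) (norm_theta_le_one (α n) (lam n) 0 0)
      (norm_theta_le_one (α n) (lam n) 0 1)
    linarith [norm_nonneg (ψ (n - 1))]
  · have := key _ _ (ψ (n - 1)) (ψ n) (norm_theta_le_one (α (n - 1)) (lam (n - 1)) 1 0)
      (norm_theta_le_one (α (n - 1)) (lam (n - 1)) 1 1)
    linarith [norm_nonneg (ψ (n + 1))]

theorem memℓp_shift (m : ℤ) (ψ : Ell2) :
    Memℓp (fun n : ℤ => ‖ψ (n + m)‖) 2 := by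
  have h := (lp.memℓp ψ).summable (by simp)
  refine memℓp_gen ?_
  simpa [Function.comp_def] using (Equiv.addRight m).summable_iff.2 h

/-- The shifted sequence of absolute values, as an element of real `ℓ²(ℤ)`. -/
def absShift (m : ℤ) (ψ : Ell2) : lp (fun _ : ℤ => ℝ) 2 := ⟨_, memℓp_shift m ψ⟩

theorem norm_absShift (m : ℤ) (ψ : Ell2) : ‖absShift m ψ‖ = ‖ψ‖ := by
  rw [lp.norm_eq_tsum_rpow (by simp), lp.norm_eq_tsum_rpow (by simp)]
  congr 1
  rw [← (Equiv.addRight m).tsum_eq (fun i : ℤ => ‖ψ i‖ ^ (2 : ENNReal).toReal)]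
  simp [absShift]

/-- The sum of the absolute values of a sequence and of its two neighbouring shifts. -/
def majorant (ψ : Ell2) : lp (fun _ : ℤ => ℝ) 2 :=
  absShift 0 ψ + absShift 1 ψ + absShift (-1) ψ

theorem norm_blockFun_le_majorant (p : ℤ) (α : ℤ → Complex.UnitDisc) (lam : ℤ → Circle)
    (ψ : Ell2) (n : ℤ) : ‖blockFun p α lam ψ n‖ ≤ majorant ψ n := by
  refine (norm_blockFun_le p α lam ψ n).trans (le_of_eq ?_)
  simp only [majorant, absShift, lp.coeFn_add, Pi.add_apply, add_zero, sub_eq_add_neg]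

/-- The direct sum of the blocks `Θ(α k, lam k)`, `k ≡ p mod 2`, as a bounded operator
on `ℓ²(ℤ)`. -/
def blockOp (p : ℤ) (α : ℤ → Complex.UnitDisc) (lam : ℤ → Circle) : Ell2 →L[ℂ] Ell2 :=
  LinearMap.mkContinuous
    { toFun := fun ψ => ⟨blockFun p α lam ψ,
        Memℓp.mono (lp.memℓp (majorant ψ)) (norm_blockFun_le_majorant p α lam ψ)⟩
      map_add' := by
        intro φ ψ
        ext n
        simp only [blockFun, lp.coeFn_add, Pi.add_apply]
        split_ifs <;> ring
      map_smul' := by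
        intro c ψ
        ext n
        simp only [blockFun, lp.coeFn_smul, Pi.smul_apply, smul_eq_mul, RingHom.id_apply]
        split_ifs <;> ring }
    3
    (by
      intro ψ
      refine (lp.norm_mono two_ne_zero (y := majorant ψ) (fun n => ?_)).trans ?_
      · exact (norm_blockFun_le_majorant p α lam ψ n).trans (le_abs_self _)
      · have h1 := norm_add_le (absShift 0 ψ + absShift 1 ψ) (absShift (-1) ψ)
        have h2 := norm_add_le (absShift 0 ψ) (absShift 1 ψ)
        rw [norm_absShift] at h1
        rw [norm_absShift, norm_absShift] at h2
        unfold majorant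
        linarith)

/-- The phased CMV operator `E = L M` with Verblunsky coefficients `α` and phases `lam`, where
`L` and `M` are the direct sums of the blocks with even and with odd index, respectively. -/
def pcmv (α : ℤ → Complex.UnitDisc) (lam : ℤ → Circle) : Ell2 →L[ℂ] Ell2 :=
  (blockOp 0 α lam).comp (blockOp 1 α lam)

/-- The set `P(q, r)` of all pCMV operators with `q`-periodic coefficients and phases
(`q` need not be the least period) and `‖α‖_∞ ≤ r`. -/
def periodicPCMV (q : ℕ) (r : ℝ) : Set (Ell2 →L[ℂ] Ell2) :=
  {E | ∃ (α : ℤ → Complex.UnitDisc) (lam : ℤ → Circle),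
    (∀ n : ℤ, α (n + q) = α n) ∧ (∀ n : ℤ, lam (n + q) = lam n) ∧
    (∀ n : ℤ, ‖(α n : ℂ)‖ ≤ r) ∧ E = pcmv α lam}

/-- Arc length measure on the unit circle (of total mass `2π`), as a measure on `ℂ`. -/
def arcLength : Measure ℂ :=
  (volume.restrict (Set.Ico (0 : ℝ) (2 * Real.pi))).map
    (fun t : ℝ => Complex.exp (t * Complex.I))

end PCMV

end

/-! A point z of the circle is an approximate eigenvalue of a unitary operator, and approximate
solutions of `E ψ = z ψ` follow the 2 × 2 transfer cocycle. Where the monodromy over a period has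
trace of modulus greater than 2, such solutions decay exponentially towards the middle of a long
stretch.

For each fixed z, a small periodic perturbation of the coefficients, still bounded by r, makes z
hyperbolic (`exists_hyperbolic_perturbation`). The monodromy lies in SU(1,1). Rotating the last
coefficient and phase of a period makes it either hyperbolic or of finite order up to sign
(`exists_rotation`); in the latter case a radial move of one coefficient, over enough periods, turns
±1 into a hyperbolic matrix (`exists_radial_perturbation`). By compactness finitely many
perturbations, m say, serve all z with a uniform margin e (`exists_finite_hyperbolic_family`).

The operator `E'` uses these m sequences one after another in each cell of length p = nq, every
stretch holding at least 2d periods, with d proportional to n. If z is in its spectrum, the j-th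
stretch is hyperbolic at z for some j, and an approximate eigenvector is of size at most about κ ^
d, κ = 2 / (2 + e), in the middle of that stretch, simultaneously in all cells. No Floquet transform
is needed: since the coefficients are p-periodic, the cocycle acts on the ℓ²-vectors formed by the
samples of ψ along residue classes mod p (`exists_decay_const`).

Replacing the odd block at this middle by the identity in every cell costs only a multiple of κ ^ d
on this eigenvector. The cut operator is a direct sum of translates of one p-dimensional operator,
so its spectrum has at most p points (`exists_finset_spectrum_subset_of_decoupled`), and by
normality z lies within 8Kκ ^ d of one of them (`exists_finset_near_of_hyperbolic`). Hence σ(E') is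
covered by mp discs of exponentially small radius. -/

noncomputable section

namespace PCMV

/-! ### Approximate eigenvectors of normal operators. -/

section Hilbert

variable {H : Type*} [NormedAddCommGroup H] [InnerProductSpace ℂ H] [CompleteSpace H]

/-- A point of the spectrum of a normal operator is an approximate eigenvalue. -/
theorem exists_approx_eigenvector {a : H →L[ℂ] H} (ha : IsStarNormal a) {z : ℂ}
    (hz : z ∈ spectrum ℂ a) {ε : ℝ} (hε : 0 < ε) :
    ∃ ψ : H, ‖ψ‖ = 1 ∧ ‖a ψ - z • ψ‖ < ε := by
  by_contra! hcon
  set b : H →L[ℂ] H := algebraMap ℂ _ z - a with hb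
  have hbapp : ∀ ψ, b ψ = z • ψ - a ψ := fun ψ => by
    simp [hb, Algebra.algebraMap_eq_smul_one]
  have hbn : IsStarNormal b := by
    refine ⟨?_⟩
    have h1 := ha.star_comm_self
    rw [hb, star_sub]
    have hc : ∀ w : ℂ, ∀ x : H →L[ℂ] H, Commute (algebraMap ℂ (H →L[ℂ] H) w) x :=
      fun w x => Algebra.commutes w x
    rw [← algebraMap_star_comm]
    exact ((hc _ _).sub_right (hc _ _)).sub_left (((hc _ _).symm).sub_right h1)
  -- Without approximate eigenvectors `b` is bounded below, so it is injective with closed range; by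
  -- normality (range b)^⊥ = ker b = 0, hence `b` is invertible.
  have hlow : ∀ ψ, ε * ‖ψ‖ ≤ ‖b ψ‖ := by
    intro ψ
    by_cases h0 : ψ = 0
    · simp [h0]
    have hn : 0 < ‖ψ‖ := norm_pos_iff.2 h0
    have := hcon (((‖ψ‖⁻¹ : ℝ) : ℂ) • ψ) (by
      rw [norm_smul, Complex.norm_real, norm_inv, norm_norm, inv_mul_cancel₀ hn.ne'])
    rw [map_smul, smul_comm, ← smul_sub, norm_smul, Complex.norm_real, norm_inv, norm_norm,
      norm_sub_rev, ← hbapp, inv_mul_eq_div, le_div_iff₀ hn] at this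
    exact this
  apply hz
  change IsUnit b
  rw [ContinuousLinearMap.isUnit_iff_bijective,
    ContinuousLinearMap.bijective_iff_dense_range_and_antilipschitz]
  have hker : b.ker = ⊥ := by
    rw [LinearMap.ker_eq_bot']
    intro m hm
    have h := hlow m
    have hm' : b m = 0 := hm
    rw [hm', norm_zero] at h
    exact norm_le_zero_iff.1 (by nlinarith)
  constructor
  · rw [Submodule.topologicalClosure_eq_top_iff]
    have := ContinuousLinearMap.IsStarNormal.orthogonal_range hbn
    rw [this, hker]
  · refine ⟨(Real.toNNReal ε)⁻¹, ?_⟩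
    refine ContinuousLinearMap.antilipschitz_of_bound b ?_
    intro x
    rw [NNReal.coe_inv, Real.coe_toNNReal _ hε.le, inv_mul_eq_div, le_div_iff₀ hε, mul_comm]
    exact hlow x

/-- An approximate eigenvector of a normal operator detects a nearby point of the spectrum. -/
theorem exists_mem_spectrum_near {a : H →L[ℂ] H} (ha : IsStarNormal a) {z : ℂ} {τ : ℝ}
    (hτ : 0 < τ) {ψ : H} (hψ : ‖a ψ - z • ψ‖ < τ * ‖ψ‖) : ∃ μ ∈ spectrum ℂ a, ‖z - μ‖ < τ := by
  by_contra! hcon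
  have hne : ∀ x ∈ spectrum ℂ a, x - z ≠ 0 := by
    intro x hx h0
    have := hcon x hx
    rw [norm_sub_rev, h0, norm_zero] at this
    linarith
  have hcont : ContinuousOn (fun x : ℂ => (x - z)⁻¹) (spectrum ℂ a) :=
    (continuousOn_id.sub continuousOn_const).inv₀ hne
  -- For a normal operator the resolvent norm is at most the inverse distance to the spectrum, which
  -- contradicts the approximate eigenvector.
  have hnorm : ‖cfc (fun x : ℂ => (x - z)⁻¹) a‖ ≤ τ⁻¹ := by
    refine norm_cfc_le (inv_nonneg.2 hτ.le) fun x hx => ?_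
    rw [norm_inv, norm_sub_rev]
    exact inv_anti₀ hτ (hcon x hx)
  have hmul : cfc (fun x : ℂ => (x - z)⁻¹) a * (a - algebraMap ℂ _ z) = 1 := by
    have h1 : a - algebraMap ℂ _ z = cfc (fun x : ℂ => x - z) a := by
      rw [cfc_sub (R := ℂ) (fun x => x) (fun _ => z) a, cfc_id' ℂ a, cfc_const z a]
    rw [h1, ← cfc_mul (fun x : ℂ => (x - z)⁻¹) (fun x : ℂ => x - z) a hcont
      (by fun_prop), ← cfc_one ℂ a]
    exact cfc_congr fun x hx => inv_mul_cancel₀ (hne x hx)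
  have happ : (cfc (fun x : ℂ => (x - z)⁻¹) a) (a ψ - z • ψ) = ψ := by
    have := congrArg (fun T : H →L[ℂ] H => T ψ) hmul
    simpa [Algebra.algebraMap_eq_smul_one] using this
  have h2 := (cfc (fun x : ℂ => (x - z)⁻¹) a).le_opNorm (a ψ - z • ψ)
  rw [happ] at h2
  have h3 : ‖ψ‖ ≤ τ⁻¹ * ‖a ψ - z • ψ‖ := h2.trans (by gcongr)
  rw [inv_mul_eq_div, le_div_iff₀ hτ] at h3
  linarith

end Hilbert

/-! ### Direct sums of general 2 × 2 blocks. -/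

/-- The action on sequences of the direct sum of arbitrary `2 × 2` blocks `Θ k`, `k ≡ p mod 2`. -/
def blockSum (p : ℤ) (Θ : ℤ → Matrix (Fin 2) (Fin 2) ℂ) (ψ : ℤ → ℂ) (n : ℤ) : ℂ :=
  if Even (n - p) then Θ n 0 0 * ψ n + Θ n 0 1 * ψ (n + 1)
  else Θ (n - 1) 1 0 * ψ (n - 1) + Θ (n - 1) 1 1 * ψ n

/-- `B` acts as the direct sum of the blocks `Θ k`, `k ≡ p mod 2`. -/
def IsBlockSum (p : ℤ) (Θ : ℤ → Matrix (Fin 2) (Fin 2) ℂ) (B : Ell2 →L[ℂ] Ell2) : Prop :=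
  ∀ (ψ : Ell2) (n : ℤ), B ψ n = blockSum p Θ ψ n

/-- General blocks are needed because the decoupling inserts identity blocks, and the identity is
never a `theta`: its off-diagonal entry would have to be ρ > 0 in modulus. -/
theorem isBlockSum_blockOp (p : ℤ) (α : ℤ → Complex.UnitDisc) (lam : ℤ → Circle) :
    IsBlockSum p (fun k => theta (α k) (lam k)) (blockOp p α lam) := fun _ _ => rfl

theorem norm_blockSum_le {Θ : ℤ → Matrix (Fin 2) (Fin 2) ℂ} {κ : ℝ}
    (hΘ : ∀ k i j, ‖Θ k i j‖ ≤ κ) (p : ℤ) (ψ : Ell2) (n : ℤ) :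
    ‖blockSum p Θ ψ n‖ ≤ κ * majorant ψ n := by
  have hκ : 0 ≤ κ := (norm_nonneg _).trans (hΘ 0 0 0)
  have key : ∀ (a b x y : ℂ), ‖a‖ ≤ κ → ‖b‖ ≤ κ → ‖a * x + b * y‖ ≤ κ * ‖x‖ + κ * ‖y‖ := by
    intro a b x y ha hb
    refine (norm_add_le _ _).trans ?_
    rw [norm_mul, norm_mul]
    gcongr
  have hm : majorant ψ n = ‖ψ n‖ + ‖ψ (n + 1)‖ + ‖ψ (n - 1)‖ := by
    simp only [majorant, absShift, lp.coeFn_add, Pi.add_apply, add_zero, sub_eq_add_neg]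
  rw [hm]
  unfold blockSum
  split_ifs
  · refine (key _ _ _ _ (hΘ _ _ _) (hΘ _ _ _)).trans ?_
    nlinarith [mul_nonneg hκ (norm_nonneg (ψ (n - 1)))]
  · refine (key _ _ _ _ (hΘ _ _ _) (hΘ _ _ _)).trans ?_
    nlinarith [mul_nonneg hκ (norm_nonneg (ψ (n + 1)))]

theorem norm_majorant_le (ψ : Ell2) : ‖majorant ψ‖ ≤ 3 * ‖ψ‖ := by
  have h1 := norm_add_le (absShift 0 ψ + absShift 1 ψ) (absShift (-1) ψ)
  have h2 := norm_add_le (absShift 0 ψ) (absShift 1 ψ)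
  rw [norm_absShift] at h1
  rw [norm_absShift, norm_absShift] at h2
  unfold majorant
  linarith

theorem norm_le_of_pointwise_majorant {κ : ℝ} (hκ : 0 ≤ κ) {φ ψ : Ell2}
    (h : ∀ n, ‖φ n‖ ≤ κ * majorant ψ n) : ‖φ‖ ≤ κ * 3 * ‖ψ‖ := by
  have h1 : ‖φ‖ ≤ ‖κ • majorant ψ‖ := by
    refine lp.norm_mono two_ne_zero fun n => (h n).trans ?_
    rw [lp.coeFn_smul, Pi.smul_apply, smul_eq_mul]
    exact le_abs_self _
  rw [norm_smul, Real.norm_eq_abs, abs_of_nonneg hκ] at h1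
  nlinarith [norm_majorant_le ψ]

theorem exists_isBlockSum {Θ : ℤ → Matrix (Fin 2) (Fin 2) ℂ} {κ : ℝ}
    (hΘ : ∀ k i j, ‖Θ k i j‖ ≤ κ) (p : ℤ) : ∃ B, IsBlockSum p Θ B := by
  have hκ : 0 ≤ κ := (norm_nonneg _).trans (hΘ 0 0 0)
  have hmem : ∀ ψ : Ell2, Memℓp (blockSum p Θ ψ) 2 := fun ψ =>
    Memℓp.mono (lp.memℓp (κ • majorant ψ)) fun n => by
      rw [lp.coeFn_smul, Pi.smul_apply, smul_eq_mul]
      exact norm_blockSum_le hΘ p ψ n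
  let T : Ell2 →ₗ[ℂ] Ell2 :=
    { toFun := fun ψ => ⟨blockSum p Θ ψ, hmem ψ⟩
      map_add' := by
        intro φ ψ
        ext n
        simp only [blockSum, lp.coeFn_add, Pi.add_apply]
        split_ifs <;> ring
      map_smul' := by
        intro c ψ
        ext n
        simp only [blockSum, lp.coeFn_smul, Pi.smul_apply, smul_eq_mul, RingHom.id_apply]
        split_ifs <;> ring }
  exact ⟨T.mkContinuous (κ * 3) fun ψ =>
    norm_le_of_pointwise_majorant hκ (norm_blockSum_le hΘ p ψ), fun ψ n => rfl⟩

theorem IsBlockSum.opNorm_sub_le {p : ℤ} {Θ Θ' : ℤ → Matrix (Fin 2) (Fin 2) ℂ}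
    {B B' : Ell2 →L[ℂ] Ell2} (hB : IsBlockSum p Θ B) (hB' : IsBlockSum p Θ' B') {κ : ℝ}
    (hΘ : ∀ k i j, ‖Θ k i j - Θ' k i j‖ ≤ κ) : ‖B - B'‖ ≤ κ * 3 := by
  have hκ : 0 ≤ κ := (norm_nonneg _).trans (hΘ 0 0 0)
  refine ContinuousLinearMap.opNorm_le_bound _ (by positivity) fun ψ =>
    norm_le_of_pointwise_majorant hκ fun n => ?_
  refine le_trans (le_of_eq ?_) (norm_blockSum_le (Θ := fun k => Θ k - Θ' k) hΘ p ψ n)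
  have : (B - B') ψ n = B ψ n - B' ψ n := rfl
  rw [this, hB, hB']
  simp only [blockSum, Matrix.sub_apply]
  split_ifs <;> ring_nf

theorem summable_norm_sq (ψ : Ell2) : Summable fun n => ‖ψ n‖ ^ 2 := by
  have h := (lp.memℓp ψ).summable (by simp)
  simpa using h

theorem norm_sq_eq_tsum (ψ : Ell2) : ‖ψ‖ ^ 2 = ∑' n, ‖ψ n‖ ^ 2 := by
  have h := lp.norm_rpow_eq_tsum (p := 2) (by simp) ψ
  simpa using h

theorem even_add_one_sub_iff (n p : ℤ) : Even (n + 1 - p) ↔ ¬ Even (n - p) := by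
  rw [show n + 1 - p = (n - p) + 1 by ring, Int.even_add_one]

theorem even_sub_one_sub_iff (n p : ℤ) : Even (n - 1 - p) ↔ ¬ Even (n - p) := by
  rw [show n - 1 - p = (n - p) - 1 by ring, Int.even_sub_one]

/-- The terms at which `P` fails are shifted by one and joined to their left neighbours; this splits
the ℓ²-norm into the contributions of the blocks. -/
theorem tsum_eq_tsum_pairs (P : ℤ → Prop) [DecidablePred P] (hP : ∀ n, P (n + 1) ↔ ¬ P n)
    {h : ℤ → ℝ} (h0 : ∀ n, 0 ≤ h n) (hs : Summable h) :
    ∑' n, h n = ∑' n, if P n then h n + h (n + 1) else 0 := by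
  set f : ℤ → ℝ := fun n => if P n then h n else 0 with hf
  set g : ℤ → ℝ := fun n => if P n then 0 else h n with hg
  have h1 : Summable f := by
    refine Summable.of_nonneg_of_le (fun n => ?_) (fun n => ?_) hs <;> simp only [hf] <;>
      split_ifs <;> first | exact h0 n | exact le_rfl
  have h2 : Summable g := by
    refine Summable.of_nonneg_of_le (fun n => ?_) (fun n => ?_) hs <;> simp only [hg] <;>
      split_ifs <;> first | exact h0 n | exact le_rfl
  have h3 : Summable fun n => g (n + 1) := (Equiv.addRight (1 : ℤ)).summable_iff.2 h2
  have e3 : ∑' n, g (n + 1) = ∑' n, g n := (Equiv.addRight (1 : ℤ)).tsum_eq g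
  calc ∑' n, h n = ∑' n, (f n + g n) := by
        refine tsum_congr fun n => ?_
        simp only [hf, hg]
        split_ifs <;> simp
    _ = ∑' n, (f n + g (n + 1)) := by rw [h1.tsum_add h2, h1.tsum_add h3, e3]
    _ = _ := by
        refine tsum_congr fun n => ?_
        simp only [hf, hg, hP]
        by_cases hn : P n <;> simp [hn]

theorem norm_sq_eq_tsum_pairs (p : ℤ) (ψ : Ell2) :
    ‖ψ‖ ^ 2 = ∑' n, if Even (n - p) then ‖ψ n‖ ^ 2 + ‖ψ (n + 1)‖ ^ 2 else 0 := by
  rw [norm_sq_eq_tsum]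
  exact tsum_eq_tsum_pairs (fun n => Even (n - p)) (fun n => even_add_one_sub_iff n p)
    (h := fun n => ‖ψ n‖ ^ 2) (fun n => by positivity)
    (summable_norm_sq ψ)

theorem norm_sq_add_norm_sq_of_unitary {U : Matrix (Fin 2) (Fin 2) ℂ}
    (hU : U.conjTranspose * U = 1) (x y : ℂ) :
    ‖U 0 0 * x + U 0 1 * y‖ ^ 2 + ‖U 1 0 * x + U 1 1 * y‖ ^ 2 = ‖x‖ ^ 2 + ‖y‖ ^ 2 := by
  have h00 := congrFun (congrFun hU 0) 0
  have h01 := congrFun (congrFun hU 0) 1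
  have h10 := congrFun (congrFun hU 1) 0
  have h11 := congrFun (congrFun hU 1) 1
  simp only [Matrix.mul_apply, Fin.sum_univ_two, Matrix.conjTranspose_apply, Matrix.one_apply,
    RCLike.star_def, if_true, Fin.isValue] at h00 h01 h10 h11
  norm_num at h01 h10
  have : (((‖U 0 0 * x + U 0 1 * y‖ ^ 2 + ‖U 1 0 * x + U 1 1 * y‖ ^ 2 : ℝ)) : ℂ)
      = ((‖x‖ ^ 2 + ‖y‖ ^ 2 : ℝ) : ℂ) := by
    push_cast
    simp only [← Complex.mul_conj', map_add, map_mul]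
    linear_combination (x * conj x) * h00 + (y * conj x) * h01 + (x * conj y) * h10
      + (y * conj y) * h11
  exact_mod_cast this

theorem IsBlockSum.norm_map {p : ℤ} {Θ : ℤ → Matrix (Fin 2) (Fin 2) ℂ} {B : Ell2 →L[ℂ] Ell2}
    (hB : IsBlockSum p Θ B) (hΘ : ∀ k, (Θ k).conjTranspose * Θ k = 1) (ψ : Ell2) :
    ‖B ψ‖ = ‖ψ‖ := by
  have h : ‖B ψ‖ ^ 2 = ‖ψ‖ ^ 2 := by
    rw [norm_sq_eq_tsum_pairs p, norm_sq_eq_tsum_pairs p]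
    refine tsum_congr fun n => ?_
    split_ifs with hn
    · have hn' : ¬ Even (n + 1 - p) := by
        rw [show n + 1 - p = (n - p) + 1 by ring, Int.even_add_one, not_not]; exact hn
      rw [hB, hB, blockSum, blockSum, if_pos hn, if_neg hn', add_sub_cancel_right]
      exact norm_sq_add_norm_sq_of_unitary (hΘ n) _ _
    · rfl
  exact (sq_eq_sq₀ (norm_nonneg _) (norm_nonneg _)).1 h

theorem norm_entry_le_one_of_unitary {U : Matrix (Fin 2) (Fin 2) ℂ}
    (hU : U ∈ Matrix.unitaryGroup (Fin 2) ℂ) (i j : Fin 2) : ‖U i j‖ ≤ 1 :=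
  entry_norm_bound_of_unitary hU i j

/-- Blockwise isometry gives `star B * B = 1`. For the other order, the block sum of the adjoint
blocks is a right inverse, and so it must be `star B`. -/
theorem IsBlockSum.mem_unitary {p : ℤ} {Θ : ℤ → Matrix (Fin 2) (Fin 2) ℂ} {B : Ell2 →L[ℂ] Ell2}
    (hB : IsBlockSum p Θ B) (hΘ : ∀ k, Θ k ∈ Matrix.unitaryGroup (Fin 2) ℂ) :
    B ∈ unitary (Ell2 →L[ℂ] Ell2) := by
  have hstar : star B * B = 1 :=
    (ContinuousLinearMap.norm_map_iff_adjoint_comp_self B).1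
      (hB.norm_map fun k => Matrix.mem_unitaryGroup_iff'.1 (hΘ k))
  obtain ⟨C, hC⟩ := exists_isBlockSum (Θ := fun k => star (Θ k)) (κ := 1)
    (fun k i j => norm_entry_le_one_of_unitary (Unitary.star_mem (hΘ k)) i j) p
  have hBC : B * C = 1 := by
    ext ψ n
    change B (C ψ) n = ψ n
    rw [hB, blockSum]
    simp only [hC _ _, blockSum]
    have hu : ∀ k i j, ∑ l, Θ k i l * star (Θ k) l j = (1 : Matrix (Fin 2) (Fin 2) ℂ) i j :=
      fun k i j => by
        rw [← Matrix.mul_apply, Matrix.mem_unitaryGroup_iff.1 (hΘ k)]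
    have h00 := fun k => hu k 0 0
    have h01 := fun k => hu k 0 1
    have h10 := fun k => hu k 1 0
    have h11 := fun k => hu k 1 1
    simp only [Fin.sum_univ_two, Matrix.one_apply] at h00 h01 h10 h11
    norm_num at h00 h01 h10 h11
    by_cases hn : Even (n - p)
    · simp only [hn, even_add_one_sub_iff, even_sub_one_sub_iff, Matrix.star_apply,
        RCLike.star_def, if_true, not_true_eq_false, if_false, add_sub_cancel_right]
      linear_combination (ψ n) * h00 n + ψ (n + 1) * h01 n
    · simp only [hn, even_add_one_sub_iff, even_sub_one_sub_iff, Matrix.star_apply,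
        RCLike.star_def, not_false_eq_true, if_true, if_false, sub_add_cancel]
      linear_combination (ψ (n - 1)) * h10 (n - 1) + ψ n * h11 (n - 1)
  have hCs : star B = C := by
    calc star B = star B * (B * C) := by rw [hBC, mul_one]
      _ = C := by rw [← mul_assoc, hstar, one_mul]
  exact ⟨hstar, by rw [hCs, hBC]⟩

/-! ### Unitarity of the pCMV operators and continuity in the coefficients. -/

theorem rho_sq (α : Complex.UnitDisc) :
    ((Real.sqrt (1 - ‖(α : ℂ)‖ ^ 2) : ℝ) : ℂ) ^ 2 = 1 - α * conj (α : ℂ) := by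
  rw [← Complex.ofReal_pow, Real.sq_sqrt (by have := α.sq_norm_lt_one; linarith),
    Complex.mul_conj']
  push_cast
  ring

theorem circle_mul_conj (lam : Circle) : (lam : ℂ) * conj (lam : ℂ) = 1 := by
  rw [Complex.mul_conj', Circle.norm_coe]
  simp

theorem theta_mem_unitaryGroup (α : Complex.UnitDisc) (lam : Circle) :
    theta α lam ∈ Matrix.unitaryGroup (Fin 2) ℂ := by
  rw [Matrix.mem_unitaryGroup_iff]
  have hl := circle_mul_conj lam
  have hr := rho_sq α
  set ρ : ℂ := ((Real.sqrt (1 - ‖(α : ℂ)‖ ^ 2) : ℝ) : ℂ) with hρ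
  have hc : conj ρ = ρ := by rw [hρ, Complex.conj_ofReal]
  have ht : theta α lam = (lam : ℂ) • !![conj (α : ℂ), ρ; ρ, -(α : ℂ)] := rfl
  rw [ht]
  generalize ρ = s at *
  ext i j
  fin_cases i <;> fin_cases j <;>
    simp [Matrix.mul_apply, Fin.sum_univ_two, Matrix.star_apply, hc]
  · linear_combination hl + lam * conj (lam : ℂ) * hr
  · ring
  · ring
  · linear_combination hl + lam * conj (lam : ℂ) * hr

theorem blockOp_mem_unitary (p : ℤ) (α : ℤ → Complex.UnitDisc) (lam : ℤ → Circle) :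
    blockOp p α lam ∈ unitary (Ell2 →L[ℂ] Ell2) :=
  (isBlockSum_blockOp p α lam).mem_unitary fun _ => theta_mem_unitaryGroup _ _

theorem norm_blockOp_apply (p : ℤ) (α : ℤ → Complex.UnitDisc) (lam : ℤ → Circle) (ψ : Ell2) :
    ‖blockOp p α lam ψ‖ = ‖ψ‖ :=
  (isBlockSum_blockOp p α lam).norm_map
    (fun _ => Matrix.mem_unitaryGroup_iff'.1 (theta_mem_unitaryGroup _ _)) ψ

theorem pcmv_mem_unitary (α : ℤ → Complex.UnitDisc) (lam : ℤ → Circle) :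
    pcmv α lam ∈ unitary (Ell2 →L[ℂ] Ell2) :=
  mul_mem (blockOp_mem_unitary 0 α lam) (blockOp_mem_unitary 1 α lam)

theorem opNorm_blockOp_le (p : ℤ) (α : ℤ → Complex.UnitDisc) (lam : ℤ → Circle) :
    ‖blockOp p α lam‖ ≤ 1 :=
  ContinuousLinearMap.opNorm_le_bound _ zero_le_one fun ψ => by
    rw [norm_blockOp_apply, one_mul]

/-- The square root term comes from ρ: |√x - √y| ≤ √|x - y|, and |α|², |β|² differ by at most 2κ.
This needs no bound keeping the coefficients away from the circle. -/
theorem norm_theta_sub_le {α β : Complex.UnitDisc} {lam μ : Circle} {κ : ℝ}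
    (hα : ‖(α : ℂ) - β‖ ≤ κ) (hl : ‖(lam : ℂ) - μ‖ ≤ κ) (i j : Fin 2) :
    ‖theta α lam i j - theta β μ i j‖ ≤ κ + κ + Real.sqrt (2 * κ) := by
  have hκ : 0 ≤ κ := (norm_nonneg _).trans hα
  have key : ∀ x y : ℂ, ‖x‖ ≤ 1 → ‖(lam : ℂ) * x - μ * y‖ ≤ κ + ‖x - y‖ := by
    intro x y hx
    rw [show (lam : ℂ) * x - μ * y = (lam - μ) * x + μ * (x - y) by ring]
    refine (norm_add_le _ _).trans ?_
    rw [norm_mul, norm_mul, Circle.norm_coe, one_mul]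
    gcongr
    nlinarith [norm_nonneg x, norm_nonneg ((lam : ℂ) - μ)]
  have hρ : |Real.sqrt (1 - ‖(α : ℂ)‖ ^ 2) - Real.sqrt (1 - ‖(β : ℂ)‖ ^ 2)|
      ≤ Real.sqrt (2 * κ) := by
    have ha := α.sq_norm_lt_one
    have hb := β.sq_norm_lt_one
    have h1 : |(1 - ‖(α : ℂ)‖ ^ 2) - (1 - ‖(β : ℂ)‖ ^ 2)| ≤ 2 * κ := by
      have h2 := abs_norm_sub_norm_le (α : ℂ) β
      rw [show (1 - ‖(α : ℂ)‖ ^ 2) - (1 - ‖(β : ℂ)‖ ^ 2)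
        = -((‖(α : ℂ)‖ - ‖(β : ℂ)‖) * (‖(α : ℂ)‖ + ‖(β : ℂ)‖)) by ring, abs_neg, abs_mul]
      have h3 : |‖(α : ℂ)‖ + ‖(β : ℂ)‖| ≤ 2 := by
        rw [abs_of_nonneg (by positivity)]
        linarith [α.norm_lt_one, β.norm_lt_one]
      nlinarith [abs_nonneg (‖(α : ℂ)‖ - ‖(β : ℂ)‖), abs_nonneg (‖(α : ℂ)‖ + ‖(β : ℂ)‖)]
    refine Real.le_sqrt_of_sq_le (le_trans ?_ h1)
    set x := 1 - ‖(α : ℂ)‖ ^ 2 with hx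
    set y := 1 - ‖(β : ℂ)‖ ^ 2 with hy
    have hxs := Real.sq_sqrt (show 0 ≤ x by linarith)
    have hys := Real.sq_sqrt (show 0 ≤ y by linarith)
    have hx0 := Real.sqrt_nonneg x
    have hy0 := Real.sqrt_nonneg y
    generalize Real.sqrt x = u at *
    generalize Real.sqrt y = v at *
    rw [← hxs, ← hys, show u ^ 2 - v ^ 2 = (u - v) * (u + v) by ring, abs_mul,
      abs_of_nonneg (add_nonneg hx0 hy0), sq]
    gcongr
    rw [abs_le]
    constructor <;> linarith
  have hs : 0 ≤ Real.sqrt (2 * κ) := Real.sqrt_nonneg _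
  have hsn : ∀ γ : Complex.UnitDisc, Real.sqrt (1 - ‖(γ : ℂ)‖ ^ 2) ≤ 1 := fun γ => by
    refine Real.sqrt_le_one.2 ?_
    nlinarith [norm_nonneg (γ : ℂ)]
  have hoff : ‖(lam : ℂ) * ((Real.sqrt (1 - ‖(α : ℂ)‖ ^ 2) : ℝ) : ℂ)
      - μ * ((Real.sqrt (1 - ‖(β : ℂ)‖ ^ 2) : ℝ) : ℂ)‖ ≤ κ + κ + Real.sqrt (2 * κ) := by
    refine (key _ _ ?_).trans ?_
    · rw [Complex.norm_real, Real.norm_eq_abs, abs_of_nonneg (Real.sqrt_nonneg _)]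
      exact hsn α
    · rw [← Complex.ofReal_sub, Complex.norm_real, Real.norm_eq_abs]
      linarith
  have h1 := α.norm_lt_one.le
  fin_cases i <;> fin_cases j
  · have := key (conj (α : ℂ)) (conj (β : ℂ)) (by simpa using h1)
    rw [← map_sub, RCLike.norm_conj] at this
    have h5 : ‖(lam : ℂ) * conj (α : ℂ) - μ * conj (β : ℂ)‖ ≤ κ + κ + Real.sqrt (2 * κ) := by
      linarith
    simpa [theta] using h5
  · simpa [theta] using hoff
  · simpa [theta] using hoff
  · have := key (-(α : ℂ)) (-(β : ℂ)) (by simpa using h1)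
    rw [neg_sub_neg, norm_sub_rev (β : ℂ)] at this
    have h5 : ‖(lam : ℂ) * -(α : ℂ) - μ * -(β : ℂ)‖ ≤ κ + κ + Real.sqrt (2 * κ) := by linarith
    simpa [theta] using h5

/-- Uniformly close coefficients give operators that are close in norm. -/
theorem exists_pos_norm_pcmv_sub_lt {δ : ℝ} (hδ : 0 < δ) : ∃ κ > 0,
    ∀ (α β : ℤ → Complex.UnitDisc) (lam μ : ℤ → Circle), (∀ n, ‖(α n : ℂ) - β n‖ ≤ κ) →
      (∀ n, ‖(lam n : ℂ) - μ n‖ ≤ κ) → ‖pcmv α lam - pcmv β μ‖ < δ := by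
  -- The factor 6 is twice the 3 of `IsBlockSum.opNorm_sub_le`, once for each of the two factors of
  -- the product.
  have hcont : Filter.Tendsto (fun κ : ℝ => 6 * (κ + κ + Real.sqrt (2 * κ)))
      (nhdsWithin 0 (Set.Ioi 0)) (nhds 0) := by
    have : Continuous fun κ : ℝ => 6 * (κ + κ + Real.sqrt (2 * κ)) := by fun_prop
    have h := this.tendsto 0
    simp only [add_zero, mul_zero, Real.sqrt_zero] at h
    exact h.mono_left nhdsWithin_le_nhds
  obtain ⟨κ, hκ, hκ0⟩ := ((hcont.eventually (gt_mem_nhds hδ)).and self_mem_nhdsWithin).exists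
  refine ⟨κ, hκ0, fun α β lam μ hα hl => lt_of_le_of_lt ?_ hκ⟩
  have hb : ∀ p, ‖blockOp p α lam - blockOp p β μ‖ ≤ (κ + κ + Real.sqrt (2 * κ)) * 3 := fun p =>
    (isBlockSum_blockOp p α lam).opNorm_sub_le (isBlockSum_blockOp p β μ) fun k i j =>
      norm_theta_sub_le (hα k) (hl k) i j
  have e : pcmv α lam - pcmv β μ = (blockOp 0 α lam - blockOp 0 β μ) * blockOp 1 α lam
      + blockOp 0 β μ * (blockOp 1 α lam - blockOp 1 β μ) := by
    change blockOp 0 α lam * blockOp 1 α lam - blockOp 0 β μ * blockOp 1 β μ = _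
    noncomm_ring
  rw [e]
  refine (norm_add_le _ _).trans ?_
  have h1 := norm_mul_le (blockOp 0 α lam - blockOp 0 β μ) (blockOp 1 α lam)
  have h2 := norm_mul_le (blockOp 0 β μ) (blockOp 1 α lam - blockOp 1 β μ)
  have h3 := opNorm_blockOp_le 1 α lam
  have h4 := opNorm_blockOp_le 0 β μ
  nlinarith [hb 0, hb 1, norm_nonneg (blockOp 0 α lam - blockOp 0 β μ),
    norm_nonneg (blockOp 1 α lam - blockOp 1 β μ)]

/-! ### Translations, and finiteness of the spectrum after decoupling. -/

theorem memℓp_comp_injective (ψ : Ell2) {e : ℤ → ℤ} (he : Function.Injective e) :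
    Memℓp (fun n : ℤ => ψ (e n)) 2 := by
  have h := (lp.memℓp ψ).summable (by simp)
  exact memℓp_gen (h.comp_injective he)

/-- Precomposition with an injective map of the index set, as an operator on `ℓ²(ℤ)`. -/
def precomp (e : ℤ → ℤ) (he : Function.Injective e) : Ell2 →L[ℂ] Ell2 :=
  LinearMap.mkContinuous
    { toFun := fun ψ => ⟨fun n => ψ (e n), memℓp_comp_injective ψ he⟩
      map_add' := fun _ _ => rfl
      map_smul' := fun _ _ => rfl }
    1
    (by
      intro ψ
      have h : ‖(⟨fun n => ψ (e n), memℓp_comp_injective ψ he⟩ : Ell2)‖ ^ 2 ≤ ‖ψ‖ ^ 2 := by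
        rw [norm_sq_eq_tsum, norm_sq_eq_tsum]
        exact tsum_comp_le_tsum_of_inj (summable_norm_sq ψ) (fun n => by positivity) he
      rw [one_mul]
      exact (sq_le_sq₀ (norm_nonneg _) (norm_nonneg _)).1 h)

@[simp] theorem precomp_apply (e : ℤ → ℤ) (he : Function.Injective e) (ψ : Ell2) (n : ℤ) :
    precomp e he ψ n = ψ (e n) := rfl

theorem norm_precomp_apply_le (e : ℤ → ℤ) (he : Function.Injective e) (ψ : Ell2) :
    ‖precomp e he ψ‖ ≤ ‖ψ‖ := by
  have h := (precomp e he).le_of_opNorm_le (LinearMap.mkContinuous_norm_le _ zero_le_one _) ψ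
  simpa using h

/-- The translation by `m` on `ℓ²(ℤ)`. -/
def translation (m : ℤ) : Ell2 →L[ℂ] Ell2 := precomp (fun n => n + m) (add_left_injective m)

@[simp] theorem translation_apply (m : ℤ) (ψ : Ell2) (n : ℤ) :
    translation m ψ n = ψ (n + m) := rfl

theorem IsBlockSum.comp_translation {p P : ℤ} {Θ : ℤ → Matrix (Fin 2) (Fin 2) ℂ}
    {B : Ell2 →L[ℂ] Ell2} (hB : IsBlockSum p Θ B) (hP : Even P)
    (hΘ : ∀ k, Θ (k + P) = Θ k) (ψ : Ell2) : B (translation P ψ) = translation P (B ψ) := by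
  ext n
  rw [hB, translation_apply, hB, blockSum, blockSum]
  have h1 : Even (n + P - p) ↔ Even (n - p) := by
    rw [show n + P - p = (n - p) + P by ring, Int.even_add]
    simp [hP]
  have h2 : Θ (n + P - 1) = Θ (n - 1) := by rw [← hΘ (n - 1)]; congr 1; ring
  simp only [h1, hΘ, h2, translation_apply]
  rw [show n + 1 + P = n + P + 1 by ring, show n - 1 + P = n + P - 1 by ring]

/-- The vectors supported in the interval `[a, a + p)`. -/
def supportedOn (a : ℤ) (p : ℕ) : Submodule ℂ Ell2 where
  carrier := {ψ | ∀ n, ¬ (a ≤ n ∧ n < a + p) → ψ n = 0}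
  add_mem' := by
    intro φ ψ hφ hψ n hn
    rw [lp.coeFn_add, Pi.add_apply, hφ n hn, hψ n hn, add_zero]
  zero_mem' := fun n _ => rfl
  smul_mem' := by
    intro c ψ hψ n hn
    rw [lp.coeFn_smul, Pi.smul_apply, hψ n hn, smul_zero]

/-- The coordinates of a vector supported in `[a, a + p)`. -/
def supportedOnCoord (a : ℤ) (p : ℕ) : supportedOn a p →ₗ[ℂ] (Fin p → ℂ) where
  toFun ψ i := (ψ : Ell2) (a + (i : ℕ))
  map_add' _ _ := rfl
  map_smul' _ _ := rfl

theorem supportedOnCoord_injective (a : ℤ) (p : ℕ) :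
    Function.Injective (supportedOnCoord a p) := by
  rw [← LinearMap.ker_eq_bot, LinearMap.ker_eq_bot']
  intro ψ hψ
  ext n
  by_cases hn : a ≤ n ∧ n < a + p
  · have h := congrFun hψ ⟨(n - a).toNat, by omega⟩
    have h' : (ψ : Ell2) (a + ((n - a).toNat : ℕ)) = 0 := h
    rw [Int.toNat_of_nonneg (by omega), add_sub_cancel] at h'
    exact h'
  · exact ψ.2 n hn

instance finite_supportedOn (a : ℤ) (p : ℕ) : Module.Finite ℂ (supportedOn a p) :=
  Module.Finite.of_injective _ (supportedOnCoord_injective a p)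

theorem finrank_supportedOn_le (a : ℤ) (p : ℕ) : Module.finrank ℂ (supportedOn a p) ≤ p := by
  simpa using LinearMap.finrank_le_finrank_of_injective (supportedOnCoord_injective a p)

/-- Transfers Cayley–Hamilton from the finite-dimensional restriction to `A` itself. -/
theorem aeval_apply_restrict {V : Submodule ℂ Ell2} {A : Ell2 →L[ℂ] Ell2}
    (hA : ∀ v ∈ V, (A : Ell2 →ₗ[ℂ] Ell2) v ∈ V) (P : Polynomial ℂ) (v : V) :
    (Polynomial.aeval A P) (v : Ell2)
      = ((Polynomial.aeval ((A : Ell2 →ₗ[ℂ] Ell2).restrict hA) P v : V) : Ell2) := by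
  induction P using Polynomial.induction_on' generalizing v with
  | add p q hp hq =>
    rw [map_add, map_add, add_apply, LinearMap.add_apply, hp, hq]
    rfl
  | monomial n c =>
    rw [Polynomial.aeval_monomial, Polynomial.aeval_monomial]
    simp only [Algebra.algebraMap_eq_smul_one, smul_mul_assoc, one_mul]
    rw [smul_apply, LinearMap.smul_apply, Submodule.coe_smul]
    congr 1
    induction n generalizing v with
    | zero => simp
    | succ n ih =>
      rw [pow_succ, pow_succ]
      exact ih ⟨A v, hA v v.2⟩

theorem eq_zero_of_single {A : Ell2 →L[ℂ] Ell2} (h : ∀ n : ℤ, A (lp.single 2 n 1) = 0) :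
    A = 0 := by
  ext1 ψ
  have hs := (lp.hasSum_single (E := fun _ : ℤ => ℂ) (p := 2) (by simp) ψ).mapL A
  have h0 : ∀ n, A (lp.single 2 n (ψ n)) = 0 := fun n => by
    have : (lp.single 2 n (ψ n) : Ell2) = ψ n • lp.single 2 n 1 := by
      rw [← lp.single_smul, smul_eq_mul, mul_one]
    rw [this, map_smul, h, smul_zero]
  simp_rw [h0] at hs
  exact hs.unique hasSum_zero

/-- An operator that commutes with the translation by `p` and leaves invariant a space of vectors
supported in an interval of length `p` has at most `p` points in its spectrum. -/
theorem exists_finset_spectrum_subset {A : Ell2 →L[ℂ] Ell2} {a : ℤ} {p : ℕ} (hp : 0 < p)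
    (hinv : ∀ ψ ∈ supportedOn a p, A ψ ∈ supportedOn a p)
    (hcomm : ∀ (k : ℤ) ψ, A (translation (k * p) ψ) = translation (k * p) (A ψ)) :
    ∃ F : Finset ℂ, F.card ≤ p ∧ spectrum ℂ A ⊆ F := by
  classical
  set R : supportedOn a p →ₗ[ℂ] supportedOn a p := (A : Ell2 →ₗ[ℂ] Ell2).restrict hinv with hR
  -- By Cayley–Hamilton `P(A)` kills the vectors of one cell; commuting with the translations, it
  -- kills every basis vector. So `P(A) = 0`, and spectral mapping puts the spectrum among the
  -- roots.
  set P := R.charpoly with hP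
  have hP0 : P ≠ 0 := (LinearMap.charpoly_monic R).ne_zero
  have hkill : ∀ ψ ∈ supportedOn a p, (Polynomial.aeval A P) ψ = 0 := fun ψ hψ => by
    have := aeval_apply_restrict hinv P ⟨ψ, hψ⟩
    rw [LinearMap.aeval_self_charpoly] at this
    exact this
  have hcP : ∀ (k : ℤ), Commute (Polynomial.aeval A P) (translation (k * p)) := by
    intro k
    have h1 : Commute A (translation (k * p)) := by
      ext1 ψ
      exact hcomm k ψ
    rw [Polynomial.aeval_eq_sum_range]
    exact Commute.sum_left _ _ _ fun i _ => (h1.pow_left i).smul_left _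
  have hzero : Polynomial.aeval A P = 0 := by
    refine eq_zero_of_single fun n => ?_
    set k := (n - a) / (p : ℤ) with hk
    have hp' : (0 : ℤ) < p := by exact_mod_cast hp
    have hb1 : 0 ≤ n - a - k * p := by
      have := Int.ediv_mul_le (n - a) hp'.ne'
      linarith
    have hb2 : n - a - k * p < p := by
      have := Int.lt_ediv_add_one_mul_self (n - a) hp'
      linarith
    have e : (lp.single 2 n 1 : Ell2) = translation (-k * p) (lp.single 2 (n - k * p) 1) := by
      ext m
      rw [translation_apply]
      by_cases hm : m = n
      · subst hm
        rw [lp.single_apply_self, show m + -k * p = m - k * p by ring, lp.single_apply_self]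
      · rw [lp.single_apply_ne _ _ _ hm, lp.single_apply_ne]
        intro h
        apply hm
        linarith
    rw [e]
    have h2 := congrArg (fun T : Ell2 →L[ℂ] Ell2 => T (lp.single 2 (n - k * p) 1)) (hcP (-k)).eq
    have h3 : (Polynomial.aeval A P) (lp.single 2 (n - k * p) 1) = 0 := by
      refine hkill _ fun m hm => ?_
      refine lp.single_apply_ne _ _ _ fun h => hm ?_
      constructor <;> linarith
    have h4 : (Polynomial.aeval A P) (translation (-k * p) (lp.single 2 (n - k * p) 1))
      = translation (-k * p) ((Polynomial.aeval A P) (lp.single 2 (n - k * p) 1)) := h2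
    rw [h4, h3, map_zero]
  refine ⟨P.roots.toFinset, ?_, ?_⟩
  · refine (Multiset.toFinset_card_le _).trans ((Polynomial.card_roots' P).trans ?_)
    rw [hP, LinearMap.charpoly_natDegree]
    exact finrank_supportedOn_le a p
  · intro z hz
    have h1 := spectrum.subset_polynomial_aeval A P ⟨z, hz, rfl⟩
    rw [hzero] at h1
    have : Nontrivial Ell2 := ⟨⟨lp.single 2 0 1, 0, fun h => by
      have := congrArg norm h
      rw [lp.norm_single (by norm_num)] at this
      simp at this⟩⟩
    rw [spectrum.zero_eq, Set.mem_singleton_iff] at h1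
    simp [hP0, h1]

/-- Decoupling: if the blocks with index `≡ s mod p`, `s` odd, are trivial, then the spectrum has
at most `p` points. -/
theorem exists_finset_spectrum_subset_of_decoupled {p : ℕ} (hp : 0 < p) (hpe : Even p) {s : ℤ}
    (hs : Odd s) {Θ Θ' : ℤ → Matrix (Fin 2) (Fin 2) ℂ} {B B' : Ell2 →L[ℂ] Ell2}
    (hB : IsBlockSum 0 Θ B) (hB' : IsBlockSum 1 Θ' B') (hΘ : ∀ k, Θ (k + p) = Θ k)
    (hΘ' : ∀ k, Θ' (k + p) = Θ' k) (h1 : Θ' s = 1) :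
    ∃ F : Finset ℂ, F.card ≤ p ∧ spectrum ℂ (B * B') ⊆ F := by
  have hper : ∀ {Ξ : ℤ → Matrix (Fin 2) (Fin 2) ℂ}, (∀ k, Ξ (k + p) = Ξ k) →
      ∀ j k : ℤ, Ξ (k + j * p) = Ξ k := by
    intro Ξ h j k
    have := Function.Periodic.int_mul (f := Ξ) (c := (p : ℤ)) h j
    exact this k
  have hpe' : ∀ j : ℤ, Even (j * p) := fun j => by
    have : Even (p : ℤ) := by exact_mod_cast hpe
    exact this.mul_left j
  -- The only odd blocks straddling the ends of the cell `[s + 1, s + 1 + p)` are those at `s` and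
  -- `s + p`, which are trivial. Even blocks straddle neither end because `s + 1` and `p` are even.
  refine exists_finset_spectrum_subset (a := s + 1) hp ?_ ?_
  · intro ψ hψ
    have hψ' : ∀ n, ¬ (s + 1 ≤ n ∧ n < s + 1 + p) → ψ n = 0 := hψ
    have hB'ψ : ∀ n, ¬ (s + 1 ≤ n ∧ n < s + 1 + p) → B' ψ n = 0 := by
      intro n hn
      rw [hB', blockSum]
      split_ifs with h
      · rw [hψ' n hn]
        by_cases hn1 : s + 1 ≤ n + 1 ∧ n + 1 < s + 1 + p
        · have : n = s := by omega
          rw [this, h1]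
          simp
        · rw [hψ' _ hn1]; ring
      · rw [hψ' n hn]
        by_cases hn1 : s + 1 ≤ n - 1 ∧ n - 1 < s + 1 + p
        · have : n - 1 = s + 1 * p := by omega
          rw [this, hper hΘ', h1]
          simp
        · rw [hψ' _ hn1]; ring
    intro n hn
    change B (B' ψ) n = 0
    have hpZ : Even (p : ℤ) := by exact_mod_cast hpe
    rw [hB, blockSum]
    split_ifs with h
    · rw [hB'ψ n hn, hB'ψ (n + 1)]
      · ring
      · rw [sub_zero] at h
        intro h2
        have : n = s := by omega
        rw [this] at h
        exact (Int.not_even_iff_odd.2 hs) h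
    · rw [hB'ψ n hn, hB'ψ (n - 1)]
      · ring
      · rw [sub_zero] at h
        intro h2
        have : n = s + 1 + p := by omega
        rw [this] at h
        exact h ((hs.add_odd odd_one).add hpZ)
  · intro k ψ
    change B (B' _) = translation _ (B (B' ψ))
    rw [hB'.comp_translation (hpe' k) (hper hΘ' k), hB.comp_translation (hpe' k) (hper hΘ k)]

/-! ### Samples along residue classes. -/

/-- Sampling along the residue class of `i` modulo `p`. -/
def sample (p : ℕ) [NeZero p] (i : ℤ) : Ell2 →L[ℂ] Ell2 :=
  precomp (fun k => i + k * p) fun k l h => by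
    have hp : (p : ℤ) ≠ 0 := by exact_mod_cast NeZero.ne p
    exact mul_right_cancel₀ hp (add_left_cancel h)

@[simp] theorem sample_apply (p : ℕ) [NeZero p] (i : ℤ) (ψ : Ell2) (k : ℤ) :
    sample p i ψ k = ψ (i + k * p) := rfl

theorem norm_sample_apply_le (p : ℕ) [NeZero p] (i : ℤ) (ψ : Ell2) :
    ‖sample p i ψ‖ ≤ ‖ψ‖ := norm_precomp_apply_le _ _ ψ

/-- Measures the effect of the cut, which lives on the two sites of the replaced blocks. The squared
norms are only compared by ≤, since the two classes may coincide. -/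
theorem norm_le_sample_add_sample (p : ℕ) [NeZero p] (i j : ℤ) {D : Ell2}
    (hD : ∀ n, (∀ k : ℤ, n ≠ i + k * p) → (∀ k : ℤ, n ≠ j + k * p) → D n = 0) :
    ‖D‖ ≤ ‖sample p i D‖ + ‖sample p j D‖ := by
  classical
  have hp : (p : ℤ) ≠ 0 := by exact_mod_cast NeZero.ne p
  have hinj : ∀ i : ℤ, Function.Injective fun k : ℤ => i + k * p := fun i k l h => by
    exact mul_right_cancel₀ hp (add_left_cancel h)
  have hcls : ∀ i : ℤ, Summable (fun n => if ∃ k : ℤ, n = i + k * p then ‖D n‖ ^ 2 else 0) ∧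
      ∑' n, (if ∃ k : ℤ, n = i + k * p then ‖D n‖ ^ 2 else 0) = ‖sample p i D‖ ^ 2 := by
    intro i
    constructor
    · refine Summable.of_nonneg_of_le (fun n => ?_) (fun n => ?_) (summable_norm_sq D) <;>
        split_ifs <;> first | positivity | exact le_rfl
    · rw [norm_sq_eq_tsum, ← (hinj i).tsum_eq]
      · refine tsum_congr fun k => ?_
        rw [if_pos ⟨k, rfl⟩, sample_apply]
      · intro n hn
        by_contra h
        apply hn
        refine if_neg ?_
        rintro ⟨k, hk⟩
        exact h ⟨k, hk.symm⟩
  have h : ‖D‖ ^ 2 ≤ ‖sample p i D‖ ^ 2 + ‖sample p j D‖ ^ 2 := by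
    rw [← (hcls i).2, ← (hcls j).2, ← (hcls i).1.tsum_add (hcls j).1, norm_sq_eq_tsum]
    refine (summable_norm_sq D).tsum_le_tsum (fun n => ?_) ((hcls i).1.add (hcls j).1)
    by_cases h1 : ∃ k : ℤ, n = i + k * p
    · rw [if_pos h1]
      split_ifs <;> [nlinarith [sq_nonneg ‖D n‖]; simp]
    · by_cases h2 : ∃ k : ℤ, n = j + k * p
      · rw [if_pos h2]
        simp [h1]
      · rw [hD n (fun k hk => h1 ⟨k, hk⟩) (fun k hk => h2 ⟨k, hk⟩)]
        simp [h1, h2]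
  refine abs_le_of_sq_le_sq' (h.trans ?_) (by positivity) |>.2
  nlinarith [norm_nonneg (sample p i D), norm_nonneg (sample p j D),
    mul_nonneg (norm_nonneg (sample p i D)) (norm_nonneg (sample p j D))]

/-! ### Transfer matrices and propagation of errors. -/

/-- The one-step transfer matrix `ρ⁻¹ [[-conj a, conj b], [b, -a]]`, `ρ = √(1 - |a|²)`. -/
def stepMatrix (a b : ℂ) : Matrix (Fin 2) (Fin 2) ℂ :=
  ((Real.sqrt (1 - ‖a‖ ^ 2) : ℝ) : ℂ)⁻¹ • !![-conj a, conj b; b, -a]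

/-- The transfer matrix taking `(ψ n, (M ψ) n)` to `(ψ (n + 1), (M ψ) (n + 1))` when
`L M ψ = z ψ`. -/
def transfer (α : ℤ → Complex.UnitDisc) (lam : ℤ → Circle) (z : Circle) (n : ℤ) :
    Matrix (Fin 2) (Fin 2) ℂ :=
  -- With φ = Mψ, an odd block relates φ to ψ, whereas an even block relates zψ = Lφ to φ. The two
  -- components exchange roles, which conjugates α, and z enters.
  if Even n then stepMatrix (conj (α n : ℂ)) (z * conj (lam n : ℂ)) else stepMatrix (α n) (lam n)

/-- The product of `n` consecutive transfer matrices starting at the site `a`. -/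
def cocycle (α : ℤ → Complex.UnitDisc) (lam : ℤ → Circle) (z : Circle) (a : ℤ) :
    ℕ → Matrix (Fin 2) (Fin 2) ℂ
  | 0 => 1
  | n + 1 => transfer α lam z (a + n) * cocycle α lam z a n

section Action

variable {X : Type*} [NormedAddCommGroup X] [NormedSpace ℂ X]

/-- The action of `2 × 2` matrices on pairs of vectors. -/
def act (T : Matrix (Fin 2) (Fin 2) ℂ) (w : X × X) : X × X :=
  (T 0 0 • w.1 + T 0 1 • w.2, T 1 0 • w.1 + T 1 1 • w.2)

theorem act_mul (S T : Matrix (Fin 2) (Fin 2) ℂ) (w : X × X) :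
    act (S * T) w = act S (act T w) := by
  ext <;> simp only [act, Matrix.mul_apply, Fin.sum_univ_two] <;> module

theorem act_one (w : X × X) : act 1 w = w := by
  ext <;> simp [act]

theorem act_sub (T : Matrix (Fin 2) (Fin 2) ℂ) (v w : X × X) :
    act T (v - w) = act T v - act T w := by
  ext <;> simp only [act, Prod.fst_sub, Prod.snd_sub] <;> module

theorem act_add_left (S T : Matrix (Fin 2) (Fin 2) ℂ) (w : X × X) :
    act (S + T) w = act S w + act T w := by
  ext <;> simp only [act, Matrix.add_apply, Prod.fst_add, Prod.snd_add] <;> module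

theorem act_smul_left (c : ℂ) (T : Matrix (Fin 2) (Fin 2) ℂ) (w : X × X) :
    act (c • T) w = c • act T w := by
  ext <;> simp only [act, Matrix.smul_apply, Prod.smul_fst, Prod.smul_snd, smul_eq_mul] <;> module

theorem norm_act_le {T : Matrix (Fin 2) (Fin 2) ℂ} {M : ℝ} (hT : ∀ i j, ‖T i j‖ ≤ M)
    (w : X × X) : ‖act T w‖ ≤ 2 * M * ‖w‖ := by
  have hM : 0 ≤ M := (norm_nonneg _).trans (hT 0 0)
  have key : ∀ i, ‖T i 0 • w.1 + T i 1 • w.2‖ ≤ 2 * M * ‖w‖ := by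
    intro i
    refine (norm_add_le _ _).trans ?_
    rw [norm_smul, norm_smul]
    have h1 := mul_le_mul (hT i 0) (norm_fst_le w) (norm_nonneg _) hM
    have h2 := mul_le_mul (hT i 1) (norm_snd_le w) (norm_nonneg _) hM
    linarith
  exact max_le (key 0) (key 1)

/-- The amplification factor of one-step errors over `n` steps. -/
def errorFactor (M : ℝ) : ℕ → ℝ
  | 0 => 0
  | n + 1 => M * errorFactor M n + M

theorem errorFactor_nonneg {M : ℝ} (hM : 0 ≤ M) (n : ℕ) : 0 ≤ errorFactor M n := by
  induction n with
  | zero => exact le_rfl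
  | succ n ih => simp only [errorFactor]; positivity

variable {α : ℤ → Complex.UnitDisc} {lam : ℤ → Circle} {z : Circle}

theorem norm_sub_act_cocycle_le {M ε : ℝ} (hM : 0 ≤ M) {v : ℤ → X × X}
    (hT : ∀ i (w : X × X), ‖act (transfer α lam z i) w‖ ≤ M * ‖w‖)
    (hv : ∀ i, ‖v (i + 1) - act (transfer α lam z i) (v i)‖ ≤ M * ε) (a : ℤ) (n : ℕ) :
    ‖v (a + n) - act (cocycle α lam z a n) (v a)‖ ≤ errorFactor M n * ε := by
  induction n with
  | zero => simp [cocycle, act_one, errorFactor]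
  | succ n ih =>
    rw [cocycle, act_mul]
    have e : v (a + (n + 1 : ℕ)) - act (transfer α lam z (a + n)) (act (cocycle α lam z a n) (v a))
        = (v (a + n + 1) - act (transfer α lam z (a + n)) (v (a + n)))
          + act (transfer α lam z (a + n)) (v (a + n) - act (cocycle α lam z a n) (v a)) := by
      rw [act_sub]
      push_cast
      rw [add_assoc a]
      abel
    rw [e]
    refine (norm_add_le _ _).trans ?_
    have h1 := hv (a + n)
    have h2 := hT (a + n) (v (a + n) - act (cocycle α lam z a n) (v a))
    simp only [errorFactor]
    nlinarith

theorem norm_act_cocycle_le {M : ℝ} (hM : 0 ≤ M)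
    (hT : ∀ i (w : X × X), ‖act (transfer α lam z i) w‖ ≤ M * ‖w‖) (a : ℤ) (n : ℕ) (w : X × X) :
    ‖act (cocycle α lam z a n) w‖ ≤ M ^ n * ‖w‖ := by
  induction n with
  | zero => simp [cocycle, act_one]
  | succ n ih =>
    rw [cocycle, act_mul, pow_succ']
    refine (hT _ _).trans ?_
    rw [mul_assoc]
    gcongr

end Action

/-! ### Exponential decay along a hyperbolic stretch. -/

/-- A nonnegative sequence that is strictly convex up to an error decays exponentially away from
the ends of its interval. -/
theorem le_pow_mul_add_of_convex {b : ℕ → ℝ} {L : ℕ} {e η B : ℝ} (he : 0 < e) (hη : 0 ≤ η)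
    (hconv : ∀ l, l + 2 ≤ L → (2 + e) * b (l + 1) ≤ b l + b (l + 2) + η)
    (hB : ∀ l, l ≤ L → b l ≤ B) (d l : ℕ) (h1 : d ≤ l) (h2 : l + d ≤ L) :
    b l ≤ (2 / (2 + e)) ^ d * B + η / e := by
  induction d generalizing l with
  | zero =>
    have := hB l (by omega)
    have : 0 ≤ η / e := by positivity
    simp
    linarith
  | succ d ih =>
    obtain ⟨l, rfl⟩ : ∃ k, l = k + 1 := ⟨l - 1, by omega⟩
    have i1 := ih l (by omega) (by omega)
    have i2 := ih (l + 2) (by omega) (by omega)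
    have h3 := hconv l (by omega)
    -- The claimed bound satisfies the recursion with equality: both neighbours are at distance at
    -- least `d` from the ends, and η / e is the fixed point of x ↦ (2x + η) / (2 + e).
    have h4 : (2 + e) * ((2 / (2 + e)) ^ (d + 1) * B + η / e)
        = 2 * ((2 / (2 + e)) ^ d * B + η / e) + η := by
      rw [pow_succ]
      field_simp
      ring
    have h5 : 0 < 2 + e := by positivity
    refine le_of_mul_le_mul_left ?_ h5
    linarith

/-- Cayley–Hamilton for determinant 1, in the form that gives the three-term relation u₂ + u₀ = (tr
T) u₁ along the orbits of `T`. -/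
theorem sq_add_one_eq_trace_smul {T : Matrix (Fin 2) (Fin 2) ℂ} (hT : T.det = 1) :
    T * T + 1 = T.trace • T := by
  rw [Matrix.det_fin_two] at hT
  ext i j
  fin_cases i <;> fin_cases j <;>
    simp [Matrix.mul_apply, Fin.sum_univ_two, Matrix.trace_fin_two]
  · linear_combination -hT
  · ring
  · ring
  · linear_combination -hT

section Decay

variable {X : Type*} [NormedAddCommGroup X] [NormedSpace ℂ X]
variable {α : ℤ → Complex.UnitDisc} {lam : ℤ → Circle} {z : Circle}

/-- Approximate solutions decay exponentially in the middle of a stretch on which the cocycle is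
periodic and hyperbolic. -/
theorem exists_decay_const {M : ℝ} (hM : 0 ≤ M)
    (hT : ∀ i (w : X × X), ‖act (transfer α lam z i) w‖ ≤ M * ‖w‖)
    {a : ℤ} {P L : ℕ} {T : Matrix (Fin 2) (Fin 2) ℂ}
    (hC : ∀ l, l < L → cocycle α lam z (a + (l * P : ℕ)) P = T) (hdet : T.det = 1) {e : ℝ}
    (he : 0 < e) (htr : 2 + e ≤ ‖T.trace‖) :
    ∃ C : ℝ, 0 ≤ C ∧ ∀ (ε : ℝ) (v : ℤ → X × X), 0 ≤ ε → (∀ i, ‖v i‖ ≤ 1) →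
      (∀ i, ‖v (i + 1) - act (transfer α lam z i) (v i)‖ ≤ M * ε) →
      ∀ d l : ℕ, d ≤ l → l + d ≤ L →
        ‖v (a + (l * P : ℕ))‖ ≤ (2 / (2 + e)) ^ d + C * ε := by
  set c := errorFactor M P with hc
  have hc0 : 0 ≤ c := errorFactor_nonneg hM P
  set t := T.trace with ht
  -- The three summands are the three one-period errors in `hid` below. The constant may be huge,
  -- which is harmless: `ε` is chosen after it.
  refine ⟨c * (1 + M ^ P + ‖t‖) / e, by positivity, fun ε v hε hv1 hv d l h1 h2 => ?_⟩
  have hblock : ∀ l, l < L →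
      ‖v (a + ((l + 1) * P : ℕ)) - act T (v (a + (l * P : ℕ)))‖ ≤ c * ε := by
    intro l hl
    have h := norm_sub_act_cocycle_le hM hT hv (a + (l * P : ℕ)) P
    rw [hC l hl] at h
    have e1 : a + (l * P : ℕ) + (P : ℤ) = a + ((l + 1) * P : ℕ) := by push_cast; ring
    rwa [e1] at h
  have := le_pow_mul_add_of_convex (b := fun l => ‖v (a + (l * P : ℕ))‖) (L := L) (B := 1)
    (η := c * (1 + M ^ P + ‖t‖) * ε) he (by positivity) ?_ (fun l _ => hv1 _) d l h1 h2
  · rw [mul_one] at this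
    rw [div_mul_eq_mul_div]
    exact this
  · intro l hl
    have hb1 := hblock l (by omega)
    have hb2 := hblock (l + 1) (by omega)
    set u0 := v (a + (l * P : ℕ)) with hu0
    set u1 := v (a + ((l + 1) * P : ℕ)) with hu1
    set u2 := v (a + ((l + 1 + 1) * P : ℕ)) with hu2
    have hT2 : act T (act T u0) + u0 = t • act T u0 := by
      rw [← act_mul, ← act_smul_left, ← sq_add_one_eq_trace_smul hdet, act_add_left, act_one]
    have hid : t • u1 = u2 + u0 - (u2 - act T u1) - act T (u1 - act T u0)
        + t • (u1 - act T u0) := by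
      rw [smul_sub, ← hT2, act_sub]
      abel
    have hTn : ‖act T (u1 - act T u0)‖ ≤ M ^ P * (c * ε) := by
      rw [← hC l (by omega)]
      refine (norm_act_cocycle_le hM hT _ _ _).trans ?_
      rw [hC l (by omega)]
      gcongr
    have hn : ‖t‖ * ‖u1‖ ≤ ‖u2‖ + ‖u0‖ + c * ε + M ^ P * (c * ε) + ‖t‖ * (c * ε) := by
      rw [← norm_smul, hid]
      refine (norm_add_le _ _).trans (add_le_add ?_ ?_)
      · refine (norm_sub_le _ _).trans (add_le_add ?_ hTn)
        refine (norm_sub_le _ _).trans (add_le_add (norm_add_le _ _) hb2)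
      · rw [norm_smul]
        gcongr
    have h3 : (2 + e) * ‖u1‖ ≤ ‖t‖ * ‖u1‖ := by gcongr
    change (2 + e) * ‖u1‖ ≤ ‖u0‖ + ‖u2‖ + _
    linarith

end Decay

/-! ### Samples of approximate eigenvectors follow the transfer matrices. -/

section Sampling

variable {α : ℤ → Complex.UnitDisc} {lam : ℤ → Circle}

theorem sqrt_one_sub_pos (α : Complex.UnitDisc) : 0 < Real.sqrt (1 - ‖(α : ℂ)‖ ^ 2) :=
  Real.sqrt_pos.2 (by have := α.sq_norm_lt_one; linarith)

theorem norm_stepMatrix_le {a b : ℂ} {K : ℝ} (hK : (Real.sqrt (1 - ‖a‖ ^ 2))⁻¹ ≤ K)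
    (ha : ‖a‖ ≤ 1) (hb : ‖b‖ ≤ 1) (i j : Fin 2) : ‖stepMatrix a b i j‖ ≤ K := by
  have h0 : 0 ≤ (Real.sqrt (1 - ‖a‖ ^ 2))⁻¹ := by positivity
  have key : ∀ x : ℂ, ‖x‖ ≤ 1 → ‖((Real.sqrt (1 - ‖a‖ ^ 2) : ℝ) : ℂ)⁻¹ * x‖ ≤ K := by
    intro x hx
    rw [norm_mul, norm_inv, Complex.norm_real, Real.norm_eq_abs,
      abs_of_nonneg (Real.sqrt_nonneg _)]
    nlinarith [norm_nonneg x]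
  fin_cases i <;> fin_cases j
  · exact key (-conj a) (by simpa using ha)
  · exact key (conj b) (by simpa using hb)
  · exact key b hb
  · exact key (-a) (by simpa using ha)

theorem norm_transfer_le {K : ℝ} (hK : ∀ n, (Real.sqrt (1 - ‖(α n : ℂ)‖ ^ 2))⁻¹ ≤ K)
    (z : Circle) (n : ℤ) (i j : Fin 2) : ‖transfer α lam z n i j‖ ≤ K := by
  unfold transfer
  split_ifs
  · exact norm_stepMatrix_le (by simpa using hK n) (by simpa using (α n).norm_lt_one.le)
      (by rw [norm_mul, RCLike.norm_conj, Circle.norm_coe, Circle.norm_coe, one_mul]) i j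
  · exact norm_stepMatrix_le (hK n) (α n).norm_lt_one.le (Circle.norm_coe _).le i j

/-- The pair formed by samples of `ψ` and of `M ψ`. -/
def samplePair (α : ℤ → Complex.UnitDisc) (lam : ℤ → Circle) (p : ℕ) [NeZero p] (ψ : Ell2)
    (i : ℤ) : Ell2 × Ell2 :=
  (sample p i ψ, sample p i (blockOp 1 α lam ψ))

theorem norm_samplePair_le (p : ℕ) [NeZero p] (ψ : Ell2) (i : ℤ) :
    ‖samplePair α lam p ψ i‖ ≤ ‖ψ‖ :=
  max_le (norm_sample_apply_le _ _ _)
    ((norm_sample_apply_le _ _ _).trans (norm_blockOp_apply 1 α lam ψ).le)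

variable {p : ℕ}

theorem even_add_mul_iff (hp : Even p) (i k : ℤ) : Even (i + k * p) ↔ Even i := by
  have : Even (p : ℤ) := by exact_mod_cast hp
  rw [Int.even_add]
  simp [this.mul_left k]

theorem apply_add_mul_eq {β : Type*} {f : ℤ → β} (hf : ∀ n, f (n + p) = f n) (i k : ℤ) :
    f (i + k * p) = f i :=
  (Function.Periodic.int_mul (f := f) (c := (p : ℤ)) hf k) i

variable [NeZero p]

/-- All sites `i + k p` carry the same block and have the same parity, so a block acts on the
ℓ²-valued samples through its scalar matrix. This replaces the Floquet transform. -/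
theorem sample_blockOp_one {α : ℤ → Complex.UnitDisc} {lam : ℤ → Circle} (hp : Even p)
    (hα : ∀ n, α (n + p) = α n) (hl : ∀ n, lam (n + p) = lam n) (ψ : Ell2) {i : ℤ}
    (hi : Odd i) :
    sample p i (blockOp 1 α lam ψ) = theta (α i) (lam i) 0 0 • sample p i ψ
        + theta (α i) (lam i) 0 1 • sample p (i + 1) ψ ∧
      sample p (i + 1) (blockOp 1 α lam ψ) = theta (α i) (lam i) 1 0 • sample p i ψ
        + theta (α i) (lam i) 1 1 • sample p (i + 1) ψ := by
  have hne : ∀ k : ℤ, Even (i + k * p - 1) := fun k => by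
    rw [Int.even_sub_one, even_add_mul_iff hp]
    exact Int.not_even_iff_odd.2 hi
  constructor <;> ext k <;>
    simp only [lp.coeFn_add, Pi.add_apply, lp.coeFn_smul, Pi.smul_apply, smul_eq_mul,
      sample_apply, isBlockSum_blockOp 1 α lam _ _, blockSum]
  · rw [if_pos (hne k), apply_add_mul_eq hα, apply_add_mul_eq hl, add_right_comm]
  · have : ¬ Even (i + 1 + k * p - 1) := by
      rw [show i + 1 + k * p - 1 = (i + k * p - 1) + 1 by ring, Int.even_add_one, not_not]
      exact hne k
    rw [if_neg this, show i + 1 + k * p - 1 = i + k * p by ring, apply_add_mul_eq hα,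
      apply_add_mul_eq hl]

theorem sample_blockOp_zero {α : ℤ → Complex.UnitDisc} {lam : ℤ → Circle} (hp : Even p)
    (hα : ∀ n, α (n + p) = α n) (hl : ∀ n, lam (n + p) = lam n) (ψ : Ell2) {i : ℤ}
    (hi : Even i) :
    sample p i (blockOp 0 α lam ψ) = theta (α i) (lam i) 0 0 • sample p i ψ
        + theta (α i) (lam i) 0 1 • sample p (i + 1) ψ ∧
      sample p (i + 1) (blockOp 0 α lam ψ) = theta (α i) (lam i) 1 0 • sample p i ψ
        + theta (α i) (lam i) 1 1 • sample p (i + 1) ψ := by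
  have hne : ∀ k : ℤ, Even (i + k * p - 0) := fun k => by
    rw [sub_zero, even_add_mul_iff hp]
    exact hi
  constructor <;> ext k <;>
    simp only [lp.coeFn_add, Pi.add_apply, lp.coeFn_smul, Pi.smul_apply, smul_eq_mul,
      sample_apply, isBlockSum_blockOp 0 α lam _ _, blockSum]
  · rw [if_pos (hne k), apply_add_mul_eq hα, apply_add_mul_eq hl, add_right_comm]
  · have : ¬ Even (i + 1 + k * p - 0) := by
      rw [show i + 1 + k * p - 0 = (i + k * p - 0) + 1 by ring, Int.even_add_one, not_not]
      exact hne k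
    rw [if_neg this, show i + 1 + k * p - 1 = i + k * p by ring, apply_add_mul_eq hα,
      apply_add_mul_eq hl]

/-- Solving the two equations of a block for the quantities at the right site. -/
theorem solve_block {X : Type*} [AddCommGroup X] [Module ℂ X] (a : Complex.UnitDisc) (μ : Circle)
    {x x' y y' : X} (h1 : y = theta a μ 0 0 • x + theta a μ 0 1 • x')
    (h2 : y' = theta a μ 1 0 • x + theta a μ 1 1 • x') :
    x' = ((Real.sqrt (1 - ‖(a : ℂ)‖ ^ 2) : ℝ) : ℂ)⁻¹ • (-conj (a : ℂ) • x + conj (μ : ℂ) • y) ∧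
    y' = ((Real.sqrt (1 - ‖(a : ℂ)‖ ^ 2) : ℝ) : ℂ)⁻¹ • ((μ : ℂ) • x - (a : ℂ) • y) := by
  have hρ := rho_sq a
  have hρ0 : ((Real.sqrt (1 - ‖(a : ℂ)‖ ^ 2) : ℝ) : ℂ) ≠ 0 := by
    exact_mod_cast (sqrt_one_sub_pos a).ne'
  have hμ := circle_mul_conj μ
  have t00 : theta a μ 0 0 = μ * conj (a : ℂ) := rfl
  have t01 : theta a μ 0 1 = μ * ((Real.sqrt (1 - ‖(a : ℂ)‖ ^ 2) : ℝ) : ℂ) := rfl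
  have t10 : theta a μ 1 0 = μ * ((Real.sqrt (1 - ‖(a : ℂ)‖ ^ 2) : ℝ) : ℂ) := rfl
  have t11 : theta a μ 1 1 = μ * -(a : ℂ) := rfl
  rw [t00, t01] at h1
  rw [t10, t11] at h2
  generalize ((Real.sqrt (1 - ‖(a : ℂ)‖ ^ 2) : ℝ) : ℂ) = ρ at *
  subst h1 h2
  constructor
  · rw [eq_inv_smul_iff₀ hρ0]
    match_scalars
    · linear_combination -ρ * hμ
    · linear_combination -conj (a : ℂ) * hμ
  · rw [eq_inv_smul_iff₀ hρ0]
    match_scalars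
    · linear_combination (μ : ℂ) * hρ
    · ring

/-- The samples of an approximate eigenvector approximately follow the transfer matrices. -/
theorem norm_samplePair_succ_sub_le (hp : Even p) (hα : ∀ n, α (n + p) = α n)
    (hl : ∀ n, lam (n + p) = lam n) {K : ℝ}
    (hK : ∀ n, (Real.sqrt (1 - ‖(α n : ℂ)‖ ^ 2))⁻¹ ≤ K) (hK1 : 1 ≤ K) (z : Circle) (ψ : Ell2)
    (i : ℤ) :
    ‖samplePair α lam p ψ (i + 1) - act (transfer α lam z i) (samplePair α lam p ψ i)‖
      ≤ 2 * K * ‖pcmv α lam ψ - (z : ℂ) • ψ‖ := by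
  set φ := blockOp 1 α lam ψ with hφ
  by_cases hi : Even i
  -- The defect `f` enters only at even sites, through Lφ = zψ + f; at odd sites φ = Mψ holds
  -- exactly. Its coefficients add up to at most K + 1 ≤ 2K in the first component and K in the
  -- second.
  · set f := pcmv α lam ψ - (z : ℂ) • ψ with hf
    have hE : blockOp 0 α lam φ = (z : ℂ) • ψ + f := by
      rw [hf, add_sub_cancel]; rfl
    obtain ⟨e1, e2⟩ := sample_blockOp_zero hp hα hl φ hi
    obtain ⟨s1, s2⟩ := solve_block (α i) (lam i) e1 e2
    rw [hE] at s1 s2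
    simp only [map_add, map_smul] at s1 s2
    have hz := circle_mul_conj z
    have hll := circle_mul_conj (lam i)
    have hconj : ‖conj (α i : ℂ)‖ = ‖(α i : ℂ)‖ := RCLike.norm_conj _
    have hρ : ‖((Real.sqrt (1 - ‖(α i : ℂ)‖ ^ 2) : ℝ) : ℂ)⁻¹‖ ≤ K := by
      rw [norm_inv, Complex.norm_real, Real.norm_eq_abs, abs_of_nonneg (Real.sqrt_nonneg _)]
      exact hK i
    have hd : samplePair α lam p ψ (i + 1) - act (transfer α lam z i) (samplePair α lam p ψ i)
        = (-(conj (z : ℂ) * (((Real.sqrt (1 - ‖(α i : ℂ)‖ ^ 2) : ℝ) : ℂ)⁻¹ * (α i : ℂ))) •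
            sample p i f - conj (z : ℂ) • sample p (i + 1) f,
          (((Real.sqrt (1 - ‖(α i : ℂ)‖ ^ 2) : ℝ) : ℂ)⁻¹ * conj (lam i : ℂ)) • sample p i f) := by
      simp only [transfer, if_pos hi, stepMatrix, act, samplePair, ← hφ, hconj]
      simp only [Matrix.smul_apply, Matrix.of_apply, Matrix.cons_val', Matrix.cons_val_zero,
        Matrix.cons_val_one, Matrix.cons_val_fin_one, smul_eq_mul, Complex.conj_conj, map_mul]
      ext1
      · simp only [Prod.fst_sub]
        have s2' : sample p (i + 1) ψ = conj (z : ℂ) •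
            (((Real.sqrt (1 - ‖(α i : ℂ)‖ ^ 2) : ℝ) : ℂ)⁻¹ • ((lam i : ℂ) • sample p i φ -
              (α i : ℂ) • ((z : ℂ) • sample p i ψ + sample p i f)) - sample p (i + 1) f) := by
          rw [← s2, add_sub_cancel_right, smul_smul, mul_comm, hz, one_smul]
        rw [s2']
        match_scalars
        · ring
        · linear_combination (-(((Real.sqrt (1 - ‖(α i : ℂ)‖ ^ 2) : ℝ) : ℂ)⁻¹ * (α i : ℂ))) * hz
        · ring
        · ring
      · simp only [Prod.snd_sub]
        rw [s1]
        module
    rw [hd]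
    have hf1 := norm_sample_apply_le p i f
    have hf2 := norm_sample_apply_le p (i + 1) f
    have hα1 := (α i).norm_lt_one.le
    have hff := norm_nonneg f
    have hK0 : 0 ≤ K := by linarith
    refine max_le ?_ ?_
    · refine (norm_sub_le _ _).trans ?_
      rw [norm_smul, norm_smul, norm_neg, norm_mul, norm_mul, RCLike.norm_conj, Circle.norm_coe,
        one_mul, one_mul]
      have h1 : ‖((Real.sqrt (1 - ‖(α i : ℂ)‖ ^ 2) : ℝ) : ℂ)⁻¹‖ * ‖(α i : ℂ)‖ ≤ K * 1 := by
        gcongr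
      have h2 := mul_le_mul h1 hf1 (norm_nonneg _) (by linarith)
      nlinarith
    · rw [norm_smul, norm_mul, RCLike.norm_conj, Circle.norm_coe, mul_one]
      have h2 := mul_le_mul hρ hf1 (norm_nonneg _) hK0
      nlinarith
  · obtain ⟨e1, e2⟩ := sample_blockOp_one hp hα hl ψ (Int.not_even_iff_odd.1 hi)
    obtain ⟨s1, s2⟩ := solve_block (α i) (lam i) e1 e2
    have hzero : samplePair α lam p ψ (i + 1)
        - act (transfer α lam z i) (samplePair α lam p ψ i) = 0 := by
      rw [sub_eq_zero]
      simp only [transfer, if_neg hi, stepMatrix, act, samplePair]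
      simp only [Matrix.smul_apply, Matrix.of_apply, Matrix.cons_val', Matrix.cons_val_zero,
        Matrix.cons_val_one, Matrix.cons_val_fin_one, smul_eq_mul]
      ext1
      · refine s1.trans ?_
        module
      · refine s2.trans ?_
        module
    rw [hzero, norm_zero]
    have hK0 : 0 ≤ K := by linarith
    positivity

end Sampling

/-! ### Cutting at a site where the approximate eigenvector is small. -/

section SpectrumNear

variable {α : ℤ → Complex.UnitDisc} {lam : ℤ → Circle}

theorem det_stepMatrix {a b : ℂ} (ha : ‖a‖ < 1) (hb : ‖b‖ = 1) : (stepMatrix a b).det = -1 := by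
  have h := rho_sq (Complex.UnitDisc.mk a ha)
  have h0 : ((Real.sqrt (1 - ‖a‖ ^ 2) : ℝ) : ℂ) ≠ 0 := by
    exact_mod_cast (sqrt_one_sub_pos (Complex.UnitDisc.mk a ha)).ne'
  have hbb : b * conj b = 1 := by rw [Complex.mul_conj', hb]; simp
  rw [Complex.UnitDisc.coe_mk] at h
  rw [stepMatrix, Matrix.det_smul, Matrix.det_fin_two_of]
  simp only [Fintype.card_fin]
  generalize ((Real.sqrt (1 - ‖a‖ ^ 2) : ℝ) : ℂ) = ρ at *
  field_simp
  linear_combination h - hbb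

theorem norm_coe_mul_conj (z w : Circle) : ‖(z : ℂ) * conj (w : ℂ)‖ = 1 := by
  rw [norm_mul, RCLike.norm_conj, Circle.norm_coe, Circle.norm_coe, one_mul]

theorem det_transfer (z : Circle) (n : ℤ) : (transfer α lam z n).det = -1 := by
  unfold transfer
  split_ifs
  · exact det_stepMatrix (by simpa using (α n).norm_lt_one) (norm_coe_mul_conj _ _)
  · exact det_stepMatrix (α n).norm_lt_one (Circle.norm_coe _)

theorem det_cocycle (z : Circle) (a : ℤ) (n : ℕ) : (cocycle α lam z a n).det = (-1) ^ n := by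
  induction n with
  | zero => simp [cocycle]
  | succ n ih => rw [cocycle, Matrix.det_mul, det_transfer, ih, pow_succ']

variable {p : ℕ} [NeZero p]

/-- The samples at both sites of an odd block are controlled by those at its right site. -/
theorem norm_sample_sub_le (hp : Even p) (hα : ∀ n, α (n + p) = α n)
    (hl : ∀ n, lam (n + p) = lam n) {K : ℝ}
    (hK : ∀ n, (Real.sqrt (1 - ‖(α n : ℂ)‖ ^ 2))⁻¹ ≤ K) (hK1 : 1 ≤ K) (ψ : Ell2) {s : ℤ}
    (hs : Odd s) :
    ‖sample p s ψ - sample p s (blockOp 1 α lam ψ)‖ ≤ 5 * K * ‖samplePair α lam p ψ (s + 1)‖ := by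
  obtain ⟨e1, e2⟩ := sample_blockOp_one hp hα hl ψ hs
  have hx : ‖sample p (s + 1) ψ‖ ≤ ‖samplePair α lam p ψ (s + 1)‖ :=
    norm_fst_le (samplePair α lam p ψ (s + 1))
  have hy : ‖sample p (s + 1) (blockOp 1 α lam ψ)‖ ≤ ‖samplePair α lam p ψ (s + 1)‖ :=
    norm_snd_le (samplePair α lam p ψ (s + 1))
  set w := ‖samplePair α lam p ψ (s + 1)‖
  have hw : 0 ≤ w := norm_nonneg _
  have hρ := hK s
  have hρ1 : ((Real.sqrt (1 - ‖(α s : ℂ)‖ ^ 2) : ℝ) : ℂ) ≠ 0 := by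
    exact_mod_cast (sqrt_one_sub_pos (α s)).ne'
  have hρn : ‖((Real.sqrt (1 - ‖(α s : ℂ)‖ ^ 2) : ℝ) : ℂ)⁻¹‖ ≤ K := by
    rw [norm_inv, Complex.norm_real, Real.norm_eq_abs, abs_of_nonneg (Real.sqrt_nonneg _)]
    exact hρ
  have hll := circle_mul_conj (lam s)
  have t10 : theta (α s) (lam s) 1 0
    = lam s * ((Real.sqrt (1 - ‖(α s : ℂ)‖ ^ 2) : ℝ) : ℂ) := rfl
  have t11 : theta (α s) (lam s) 1 1 = lam s * -(α s : ℂ) := rfl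
  have hxs : sample p s ψ = ((Real.sqrt (1 - ‖(α s : ℂ)‖ ^ 2) : ℝ) : ℂ)⁻¹ •
      (conj (lam s : ℂ) • sample p (s + 1) (blockOp 1 α lam ψ)
        + (α s : ℂ) • sample p (s + 1) ψ) := by
    rw [eq_inv_smul_iff₀ hρ1, e2, t10, t11]
    match_scalars
    · linear_combination -((Real.sqrt (1 - ‖(α s : ℂ)‖ ^ 2) : ℝ) : ℂ) * hll
    · linear_combination (α s : ℂ) * hll
  have hb1 : ‖sample p s ψ‖ ≤ K * (w + w) := by
    rw [hxs, norm_smul]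
    refine mul_le_mul hρn ?_ (norm_nonneg _) (by linarith)
    refine (norm_add_le _ _).trans (add_le_add ?_ ?_)
    · rw [norm_smul, RCLike.norm_conj, Circle.norm_coe, one_mul]
      exact hy
    · rw [norm_smul]
      have := mul_le_mul (α s).norm_lt_one.le hx (norm_nonneg _) zero_le_one
      linarith
  have hb2 : ‖sample p s (blockOp 1 α lam ψ)‖ ≤ K * (w + w) + w := by
    rw [e1]
    refine (norm_add_le _ _).trans (add_le_add ?_ ?_)
    · rw [norm_smul]
      have := mul_le_mul (norm_theta_le_one (α s) (lam s) 0 0) hb1 (norm_nonneg _) zero_le_one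
      linarith
    · rw [norm_smul]
      have := mul_le_mul (norm_theta_le_one (α s) (lam s) 0 1) hx (norm_nonneg _) zero_le_one
      linarith
  have := norm_sub_le (sample p s ψ) (sample p s (blockOp 1 α lam ψ))
  nlinarith

/-- Approximate eigenvectors of a periodic operator that are small at one site per period detect
the spectrum of a decoupled operator. -/
theorem exists_finset_near_of_small (hp : Even p) (hα : ∀ n, α (n + p) = α n)
    (hl : ∀ n, lam (n + p) = lam n) {K : ℝ}
    (hK : ∀ n, (Real.sqrt (1 - ‖(α n : ℂ)‖ ^ 2))⁻¹ ≤ K) (hK1 : 1 ≤ K) {s : ℤ} (hs : Odd s) :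
    ∃ F : Finset ℂ, F.card ≤ p ∧ ∀ (z : ℂ) (τ : ℝ) (ψ : Ell2), 0 < τ → ‖ψ‖ = 1 →
      ‖pcmv α lam ψ - z • ψ‖ + 7 * K * ‖samplePair α lam p ψ (s + 1)‖ < τ →
      ∃ μ ∈ F, ‖z - μ‖ < τ := by
  classical
  have hp0 : (p : ℤ) ≠ 0 := by exact_mod_cast NeZero.ne p
  have hpe : Even (p : ℤ) := by exact_mod_cast hp
  -- The cut: one odd block in each cell becomes the identity. Below, `D` is the resulting change of
  -- Mψ, supported on the two sites of the cut blocks.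
  set Θ : ℤ → Matrix (Fin 2) (Fin 2) ℂ := fun k =>
    if (p : ℤ) ∣ k - s then 1 else theta (α k) (lam k) with hΘ
  have hΘu : ∀ k, Θ k ∈ Matrix.unitaryGroup (Fin 2) ℂ := by
    intro k
    simp only [hΘ]
    split_ifs
    · exact one_mem _
    · exact theta_mem_unitaryGroup _ _
  obtain ⟨M₀, hM₀⟩ := exists_isBlockSum (Θ := Θ) (κ := 1)
    (fun k i j => norm_entry_le_one_of_unitary (hΘu k) i j) 1
  have hL := isBlockSum_blockOp 0 α lam
  obtain ⟨F, hF, hsub⟩ := exists_finset_spectrum_subset_of_decoupled (NeZero.pos p) hp hs hL hM₀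
    (fun k => by simp only [hα, hl])
    (fun k => by
      have : (p : ℤ) ∣ k + p - s ↔ (p : ℤ) ∣ k - s := by
        rw [show k + (p : ℤ) - s = (k - s) + p by ring]
        exact dvd_add_self_right
      simp only [hΘ, hα, hl, this])
    (by simp [hΘ])
  refine ⟨F, hF, fun z τ ψ hτ hψ hlt => ?_⟩
  have hU : IsStarNormal (blockOp 0 α lam * M₀) := by
    have := mul_mem (blockOp_mem_unitary 0 α lam) (hM₀.mem_unitary hΘu)
    exact ⟨by rw [commute_iff_eq, this.1, this.2]⟩
  set D : Ell2 := M₀ ψ - blockOp 1 α lam ψ with hD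
  have hDapp : ∀ n, D n = M₀ ψ n - blockOp 1 α lam ψ n := fun n => rfl
  have hfix : ∀ n, (∃ k : ℤ, n = s + k * p) ∨ (∃ k : ℤ, n = s + 1 + k * p) →
      M₀ ψ n = ψ n := by
    rintro n (⟨k, rfl⟩ | ⟨k, rfl⟩)
    · have he : Even (s + k * p - 1) := by
        rw [Int.even_sub_one, even_add_mul_iff hp]
        exact Int.not_even_iff_odd.2 hs
      have h1 : Θ (s + k * p) = 1 := by simp [hΘ]
      rw [hM₀, blockSum, if_pos he, h1]
      simp
    · have he : ¬ Even (s + 1 + k * p - 1) := by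
        rw [show s + 1 + k * p - 1 = s + k * p by ring, even_add_mul_iff hp]
        exact Int.not_even_iff_odd.2 hs
      have h1 : Θ (s + 1 + k * p - 1) = 1 := by
        simp [hΘ, show s + 1 + k * p - 1 - s = k * p by ring]
      rw [hM₀, blockSum, if_neg he, h1]
      simp
  have hDzero : ∀ n, (∀ k : ℤ, n ≠ s + k * p) → (∀ k : ℤ, n ≠ s + 1 + k * p) → D n = 0 := by
    intro n h1 h2
    have e1 : Θ n = theta (α n) (lam n) := by
      simp only [hΘ]
      rw [if_neg]
      rintro ⟨k, hk⟩
      exact h1 k (by linarith)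
    have e2 : Θ (n - 1) = theta (α (n - 1)) (lam (n - 1)) := by
      simp only [hΘ]
      rw [if_neg]
      rintro ⟨k, hk⟩
      exact h2 k (by linarith)
    rw [hDapp, hM₀, isBlockSum_blockOp 1 α lam ψ n, blockSum, blockSum, e1, e2, sub_self]
  have hDs : ∀ i, i = s ∨ i = s + 1 →
      sample p i D = sample p i ψ - sample p i (blockOp 1 α lam ψ) := by
    intro i hi
    ext k
    rw [sample_apply, hDapp, hfix]
    · rfl
    · rcases hi with rfl | rfl
      · exact Or.inl ⟨k, rfl⟩
      · exact Or.inr ⟨k, rfl⟩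
  -- The site `s` contributes 5K and the site `s + 1` contributes 2 ≤ 2K.
  have hDn : ‖D‖ ≤ 7 * K * ‖samplePair α lam p ψ (s + 1)‖ := by
    refine (norm_le_sample_add_sample p s (s + 1) hDzero).trans ?_
    rw [hDs s (Or.inl rfl), hDs (s + 1) (Or.inr rfl)]
    have h1 := norm_sample_sub_le hp hα hl hK hK1 ψ hs
    have h2 := norm_sub_le (sample p (s + 1) ψ) (sample p (s + 1) (blockOp 1 α lam ψ))
    have hx : ‖sample p (s + 1) ψ‖ ≤ ‖samplePair α lam p ψ (s + 1)‖ :=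
    norm_fst_le (samplePair α lam p ψ (s + 1))
    have hy : ‖sample p (s + 1) (blockOp 1 α lam ψ)‖ ≤ ‖samplePair α lam p ψ (s + 1)‖ :=
      norm_snd_le (samplePair α lam p ψ (s + 1))
    nlinarith [norm_nonneg (samplePair α lam p ψ (s + 1))]
  have hlt' : ‖(blockOp 0 α lam * M₀) ψ - z • ψ‖ < τ * ‖ψ‖ := by
    have e : (blockOp 0 α lam * M₀) ψ - z • ψ
        = blockOp 0 α lam D + (pcmv α lam ψ - z • ψ) := by
      rw [hD, map_sub]
      change blockOp 0 α lam (M₀ ψ) - z • ψ = _ - _ + (blockOp 0 α lam (blockOp 1 α lam ψ) - _)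
      abel
    rw [e, hψ, mul_one]
    refine (norm_add_le _ _).trans_lt ?_
    rw [norm_blockOp_apply]
    linarith
  obtain ⟨μ, hμ, h⟩ := exists_mem_spectrum_near hU hτ hlt'
  exact ⟨μ, hsub hμ, h⟩

/-- The part of the spectrum where the cocycle is hyperbolic along a stretch of `L` periods in each
cell lies exponentially close to a set of at most `p` points. -/
theorem exists_finset_near_of_hyperbolic (hp : Even p) (hα : ∀ n, α (n + p) = α n)
    (hl : ∀ n, lam (n + p) = lam n) {K : ℝ}
    (hK : ∀ n, (Real.sqrt (1 - ‖(α n : ℂ)‖ ^ 2))⁻¹ ≤ K) (hK1 : 1 ≤ K) {a : ℤ} (ha : Even a)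
    {P : ℕ} (hP : Even P) {d : ℕ} (hd : 0 < d) {e : ℝ} (he : 0 < e) :
    ∃ F : Finset ℂ, F.card ≤ p ∧ ∀ z : Circle, (z : ℂ) ∈ spectrum ℂ (pcmv α lam) →
      (∃ T, (∀ l, l < 2 * d → cocycle α lam z (a + (l * P : ℕ)) P = T) ∧ 2 + e ≤ ‖T.trace‖) →
      ∃ μ ∈ F, ‖(z : ℂ) - μ‖ < 8 * K * (2 / (2 + e)) ^ d := by
  -- The block to be cut ends at `a + d P`, the midpoint of the stretch of 2d periods, where decay
  -- from both ends gives the exponent `d`.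
  have hs : Odd (a + (d * P : ℕ) - 1) := by
    have : Even ((d * P : ℕ) : ℤ) := by exact_mod_cast hP.mul_left d
    exact (ha.add this).sub_odd odd_one
  obtain ⟨F, hF, hnear⟩ := exists_finset_near_of_small hp hα hl hK hK1 hs
  refine ⟨F, hF, fun z hz ⟨T, hT, htr⟩ => ?_⟩
  have hK0 : 0 < K := by linarith
  have hdet : T.det = 1 := by
    rw [← hT 0 (by omega), det_cocycle, hP.neg_one_pow]
  obtain ⟨C, hC0, hC⟩ := exists_decay_const (X := Ell2) (M := 2 * K) (by positivity)
    (fun i w => norm_act_le (norm_transfer_le hK z i) w) hT hdet he htr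
  set κ := (2 / (2 + e)) ^ d with hκ
  have hκ0 : 0 < κ := by positivity
  -- Chosen so that ε + 7K(κ + Cε) = 8Kκ.
  set ε := K * κ / (1 + 7 * K * C) with hε
  have hden : 0 < 1 + 7 * K * C := by positivity
  have hε0 : 0 < ε := by positivity
  have hnorm : IsStarNormal (pcmv α lam) := by
    have := pcmv_mem_unitary α lam
    exact ⟨by rw [commute_iff_eq, this.1, this.2]⟩
  obtain ⟨ψ, hψ, hψε⟩ := exists_approx_eigenvector hnorm hz hε0
  have hdec := hC ε (samplePair α lam p ψ) hε0.le
    (fun i => (norm_samplePair_le p ψ i).trans hψ.le)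
    (fun i => (norm_samplePair_succ_sub_le hp hα hl hK hK1 z ψ i).trans (by gcongr))
    d d le_rfl (by omega)
  refine hnear z _ ψ (by positivity) hψ ?_
  rw [sub_add_cancel]
  have hmul : ε * (1 + 7 * K * C) = K * κ := div_mul_cancel₀ _ hden.ne'
  have h7 : 7 * K * ‖samplePair α lam p ψ (a + (d * P : ℕ))‖ ≤ 7 * K * (κ + C * ε) := by gcongr
  nlinarith

end SpectrumNear

/-! ### Powers and rotations of unimodular 2 × 2 matrices. -/

section TwoByTwo

/-- The Chebyshev formula for powers, multiplied by sin φ to avoid a division; the induction is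
Cayley–Hamilton together with the addition formula for the sine. -/
theorem sin_smul_pow_succ {T : Matrix (Fin 2) (Fin 2) ℂ} (hdet : T.det = 1) {φ : ℝ}
    (htr : T.trace = 2 * (Real.cos φ : ℂ)) (n : ℕ) :
    (Real.sin φ : ℂ) • T ^ (n + 1)
      = (Real.sin ((n + 1) * φ) : ℂ) • T - (Real.sin (n * φ) : ℂ) • 1 := by
  have hCH := sq_add_one_eq_trace_smul hdet
  have hTT : T * T = T.trace • T - 1 := by rw [← hCH, add_sub_cancel_right]
  induction n with
  | zero => simp
  | succ n ih =>
    rw [pow_succ, ← smul_mul_assoc, ih, sub_mul, smul_mul_assoc, smul_mul_assoc, one_mul, hTT, htr]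
    have h1 : (Real.sin (((n + 1 : ℕ) + 1) * φ) : ℂ)
        = 2 * (Real.cos φ : ℂ) * (Real.sin ((n + 1) * φ) : ℂ) - (Real.sin (n * φ) : ℂ) := by
      have e1 : (((n + 1 : ℕ) : ℝ) + 1) * φ = (n + 1) * φ + φ := by push_cast; ring
      have e2 : (n : ℝ) * φ = (n + 1) * φ - φ := by ring
      rw [e1, e2, Real.sin_add, Real.sin_sub]
      push_cast
      ring
    rw [h1, Nat.cast_succ]
    module

/-- An elliptic unimodular matrix with rational rotation number has a power equal to `±1`. -/
theorem pow_eq_one_or_neg_one {T : Matrix (Fin 2) (Fin 2) ℂ} (hdet : T.det = 1) {φ : ℝ}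
    (htr : T.trace = 2 * (Real.cos φ : ℂ)) (hsin : Real.sin φ ≠ 0) {N : ℕ} (hN : 0 < N) {j : ℤ}
    (hφ : N * φ = j * Real.pi) : T ^ N = 1 ∨ T ^ N = -1 := by
  obtain ⟨n, rfl⟩ : ∃ n, N = n + 1 := ⟨N - 1, by omega⟩
  have h := sin_smul_pow_succ hdet htr n
  push_cast at hφ
  have h2 : (n : ℝ) * φ = j * Real.pi - φ := by rw [← hφ]; ring
  rw [hφ, h2, Real.sin_sub, Real.sin_int_mul_pi] at h
  have hs : (Real.sin φ : ℂ) ≠ 0 := by exact_mod_cast hsin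
  have h3 : T ^ (n + 1) = (Real.cos (j * Real.pi) : ℂ) • 1 := by
    apply smul_right_injective _ hs
    simp only
    rw [h]
    push_cast
    module
  rcases Int.even_or_odd j with hj | hj
  · left
    obtain ⟨k, rfl⟩ := hj
    rw [h3, show (((k + k : ℤ) : ℝ)) * Real.pi = k * (2 * Real.pi) by push_cast; ring,
      Real.cos_int_mul_two_pi]
    simp
  · right
    obtain ⟨k, rfl⟩ := hj
    rw [h3, show (((2 * k + 1 : ℤ) : ℝ)) * Real.pi = k * (2 * Real.pi) + Real.pi by
      push_cast; ring, Real.cos_int_mul_two_pi_add_pi]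
    simp

/-- A small rotation makes an element of `SU(1,1)` hyperbolic or of finite order up to sign. -/
theorem exists_rotation {T : Matrix (Fin 2) (Fin 2) ℂ} (hdet : T.det = 1)
    (h11 : T 1 1 = conj (T 0 0)) (h10 : T 1 0 = conj (T 0 1)) {θ₀ : ℝ} (hθ₀ : 0 < θ₀) :
    ∃ θ : ℝ, |θ| ≤ θ₀ ∧
      (2 < ‖(!![conj (Circle.exp θ : ℂ), 0; 0, (Circle.exp θ : ℂ)] * T).trace‖ ∨
        ∃ N : ℕ, 0 < N ∧ ((!![conj (Circle.exp θ : ℂ), 0; 0, (Circle.exp θ : ℂ)] * T) ^ N = 1 ∨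
          (!![conj (Circle.exp θ : ℂ), 0; 0, (Circle.exp θ : ℂ)] * T) ^ N = -1)) := by
  set G : ℝ → Matrix (Fin 2) (Fin 2) ℂ := fun θ =>
    !![conj (Circle.exp θ : ℂ), 0; 0, (Circle.exp θ : ℂ)] * T with hG
  -- The trace of the rotated matrix is real: it is 2 Re(e^{-iθ} T₀₀).
  set D : ℝ → ℝ := fun θ => 2 * (Real.cos θ * (T 0 0).re + Real.sin θ * (T 0 0).im) with hD
  have htr : ∀ θ, (G θ).trace = (D θ : ℂ) := by
    intro θ
    have : (G θ).trace = conj (Circle.exp θ : ℂ) * T 0 0 + (Circle.exp θ : ℂ) * T 1 1 := by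
      simp only [hG, Matrix.trace_fin_two, Matrix.mul_apply, Fin.sum_univ_two, Matrix.of_apply,
        Matrix.cons_val', Matrix.cons_val_zero, Matrix.cons_val_one, Matrix.cons_val_fin_one]
      ring
    rw [this, h11, Circle.coe_exp, Complex.exp_mul_I, ← Complex.ofReal_cos, ← Complex.ofReal_sin]
    apply Complex.ext <;> simp [hD] <;> ring
  have hGdet : ∀ θ, (G θ).det = 1 := by
    intro θ
    have := circle_mul_conj (Circle.exp θ)
    simp only [hG, Matrix.det_mul, hdet, Matrix.det_fin_two_of]
    linear_combination this
  have hcont : Continuous D := by fun_prop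
  by_cases hbig : ∃ θ, |θ| ≤ θ₀ ∧ 2 < |D θ|
  · obtain ⟨θ, h1, h2⟩ := hbig
    refine ⟨θ, h1, Or.inl ?_⟩
    change 2 < ‖(G θ).trace‖
    rw [htr, Complex.norm_real]
    exact h2
  push Not at hbig
  -- If the sinusoid `D` were constant near 0 then T₀₀ = 0, and the determinant -|T₀₁|² could not be
  -- 1.
  have hne : ∃ x y, |x| ≤ θ₀ ∧ |y| ≤ θ₀ ∧ D x < D y := by
    by_contra! hcon
    have hconst : ∀ x y, |x| ≤ θ₀ → |y| ≤ θ₀ → D x = D y := fun x y hx hy =>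
      le_antisymm (hcon y x hy hx) (hcon x y hx hy)
    set h := min θ₀ 1 with hh
    have h0 : 0 < h := lt_min hθ₀ one_pos
    have hle : h ≤ θ₀ := min_le_left _ _
    have hle1 : h ≤ 1 := min_le_right _ _
    have e1 := hconst 0 h (by simp [hθ₀.le]) (by rwa [abs_of_pos h0])
    have e2 := hconst 0 (-h) (by simp [hθ₀.le]) (by rwa [abs_neg, abs_of_pos h0])
    have hpi := Real.pi_gt_three
    have hs : 0 < Real.sin h := Real.sin_pos_of_pos_of_lt_pi h0 (by linarith)
    have hc : Real.cos h < 1 := by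
      have := Real.cos_lt_cos_of_nonneg_of_le_pi (x := 0) (y := h) le_rfl (by linarith) h0
      rwa [Real.cos_zero] at this
    simp only [hD, Real.cos_zero, Real.sin_zero, Real.cos_neg, Real.sin_neg] at e1 e2
    have him : (T 0 0).im = 0 := by
      have : Real.sin h * (T 0 0).im = 0 := by linarith
      rcases mul_eq_zero.1 this with h | h
      · exact absurd h hs.ne'
      · exact h
    have hre : (T 0 0).re = 0 := by
      rw [him] at e1
      have : (1 - Real.cos h) * (T 0 0).re = 0 := by linarith
      rcases mul_eq_zero.1 this with h | h
      · linarith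
      · exact h
    have h00 : T 0 0 = 0 := Complex.ext hre him
    rw [Matrix.det_fin_two, h10, h00, zero_mul, zero_sub, Complex.mul_conj] at hdet
    have hr : -Complex.normSq (T 0 1) = 1 := by exact_mod_cast hdet
    linarith [Complex.normSq_nonneg (T 0 1)]
  obtain ⟨x, y, hx, hy, hxy⟩ := hne
  have hrange : ∀ θ, |θ| ≤ θ₀ → -1 ≤ D θ / 2 ∧ D θ / 2 ≤ 1 := fun θ hθ => by
    have := abs_le.1 (hbig θ hθ)
    constructor <;> linarith
  have hacos : Real.arccos (D y / 2) < Real.arccos (D x / 2) :=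
    Real.strictAntiOn_arccos (Set.mem_Icc.2 (hrange x hx)) (Set.mem_Icc.2 (hrange y hy))
      (by linarith)
  -- The rotation angle arccos(D / 2) varies, so it equals tπ at some θ for a rational t strictly
  -- between 0 and 1; strictness keeps sin(tπ) nonzero.
  obtain ⟨t, ht1, ht2⟩ := exists_rat_btwn (div_lt_div_of_pos_right hacos Real.pi_pos)
  rw [div_lt_iff₀ Real.pi_pos] at ht1
  rw [lt_div_iff₀ Real.pi_pos] at ht2
  have hivt := intermediate_value_uIcc (a := x) (b := y) (f := fun θ => Real.arccos (D θ / 2))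
    (by fun_prop)
  obtain ⟨θ, hθ, hθt⟩ := hivt (Set.mem_uIcc.2 (Or.inr ⟨ht1.le, ht2.le⟩))
  have hθ0 : |θ| ≤ θ₀ := by
    rw [abs_le] at hx hy ⊢
    rcases Set.mem_uIcc.1 hθ with h | h <;> constructor <;> linarith
  refine ⟨θ, hθ0, Or.inr ⟨t.den, t.den_pos, ?_⟩⟩
  refine pow_eq_one_or_neg_one (hGdet θ) (φ := t * Real.pi) (j := t.num) ?_ ?_ t.den_pos ?_
  · rw [htr, ← hθt, Real.cos_arccos (hrange θ hθ0).1 (hrange θ hθ0).2]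
    push_cast
    ring
  · refine (Real.sin_pos_of_pos_of_lt_pi ?_ ?_).ne'
    · exact (Real.arccos_nonneg _).trans_lt ht1
    · exact ht2.trans_le (Real.arccos_le_pi _)
  · have : ((t.den : ℝ)) * t = t.num := by exact_mod_cast t.den_mul_eq_num
    rw [← mul_assoc, this]

end TwoByTwo

/-! ### Algebra of cocycles and perturbation to hyperbolicity. -/

section Cocycle

variable {α β : ℤ → Complex.UnitDisc} {lam μ : ℤ → Circle} {z : Circle}

theorem cocycle_congr {a : ℤ} {n : ℕ} (h : ∀ i : ℕ, i < n → α (a + i) = β (a + i))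
    (h' : ∀ i : ℕ, i < n → lam (a + i) = μ (a + i)) :
    cocycle α lam z a n = cocycle β μ z a n := by
  induction n with
  | zero => rfl
  | succ n ih =>
    rw [cocycle, cocycle, ih (fun i hi => h i (by omega)) (fun i hi => h' i (by omega)), transfer,
      transfer, h n (by omega), h' n (by omega)]

theorem cocycle_add (a : ℤ) (m n : ℕ) :
    cocycle α lam z a (m + n) = cocycle α lam z (a + m) n * cocycle α lam z a m := by
  induction n with
  | zero => simp [cocycle]
  | succ n ih =>
    rw [← add_assoc, cocycle, ih, cocycle, mul_assoc]
    push_cast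
    rw [add_assoc]

theorem transfer_periodic {P : ℕ} (hP : Even P) (hα : ∀ n, α (n + P) = α n)
    (hl : ∀ n, lam (n + P) = lam n) (k n : ℤ) :
    transfer α lam z (n + k * P) = transfer α lam z n := by
  rw [transfer, transfer, apply_add_mul_eq hα, apply_add_mul_eq hl]
  simp only [even_add_mul_iff hP]

theorem cocycle_periodic {P : ℕ} (hP : Even P) (hα : ∀ n, α (n + P) = α n)
    (hl : ∀ n, lam (n + P) = lam n) (k a : ℤ) (n : ℕ) :
    cocycle α lam z (a + k * P) n = cocycle α lam z a n := by
  induction n with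
  | zero => rfl
  | succ n ih => rw [cocycle, cocycle, ih, add_right_comm, transfer_periodic hP hα hl]

theorem cocycle_mul_period {P : ℕ} (hP : Even P) (hα : ∀ n, α (n + P) = α n)
    (hl : ∀ n, lam (n + P) = lam n) (N : ℕ) :
    cocycle α lam z 0 (N * P) = cocycle α lam z 0 P ^ N := by
  induction N with
  | zero => simp [cocycle]
  | succ N ih =>
    have := cocycle_periodic (z := z) hP hα hl N 0 P
    rw [add_mul, one_mul, cocycle_add, ih, pow_succ']
    push_cast
    rw [this]

theorem stepMatrix_apply_one_one (a b : ℂ) : stepMatrix a b 1 1 = conj (stepMatrix a b 0 0) := by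
  simp [stepMatrix]

theorem stepMatrix_apply_one_zero (a b : ℂ) : stepMatrix a b 1 0 = conj (stepMatrix a b 0 1) := by
  simp [stepMatrix]

/-- Together with determinant (-1)ⁿ this places cocycles of even length in SU(1,1), as
`exists_rotation` requires. -/
theorem cocycle_conj (a : ℤ) (n : ℕ) :
    cocycle α lam z a n 1 1 = conj (cocycle α lam z a n 0 0) ∧
      cocycle α lam z a n 1 0 = conj (cocycle α lam z a n 0 1) := by
  have ht : ∀ i, transfer α lam z i 1 1 = conj (transfer α lam z i 0 0) ∧
      transfer α lam z i 1 0 = conj (transfer α lam z i 0 1) := by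
    intro i
    unfold transfer
    split_ifs <;> exact ⟨stepMatrix_apply_one_one _ _, stepMatrix_apply_one_zero _ _⟩
  induction n with
  | zero => simp [cocycle]
  | succ n ih =>
    obtain ⟨h1, h2⟩ := ht (a + n)
    obtain ⟨i1, i2⟩ := ih
    simp only [cocycle, Matrix.mul_apply, Fin.sum_univ_two, h1, h2, i1, i2, map_add, map_mul,
      Complex.conj_conj]
    constructor <;> ring

/-- Rotating coefficient and phase together preserves ρ and multiplies the step matrix on the left
by a diagonal rotation, so the rotation of `exists_rotation` is realised without changing |α|. -/
theorem stepMatrix_rotate (u : Circle) (a : ℂ) (b : ℂ) :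
    stepMatrix (u * a) (u * b) = !![conj (u : ℂ), 0; 0, (u : ℂ)] * stepMatrix a b := by
  have hn : ‖(u : ℂ) * a‖ = ‖a‖ := by rw [norm_mul, Circle.norm_coe, one_mul]
  rw [stepMatrix, stepMatrix, hn]
  ext i j
  fin_cases i <;> fin_cases j <;> simp [Matrix.mul_apply, Fin.sum_univ_two] <;> ring

/-- The explicit inverse lets a changed last step be compared with the original one. -/
theorem stepMatrix_left_inv {a b : ℂ} (ha : ‖a‖ < 1) (hb : ‖b‖ = 1) :
    ((Real.sqrt (1 - ‖a‖ ^ 2) : ℝ) : ℂ)⁻¹ • !![a, conj b; b, conj a] * stepMatrix a b = 1 := by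
  have h := rho_sq (Complex.UnitDisc.mk a ha)
  have h0 : ((Real.sqrt (1 - ‖a‖ ^ 2) : ℝ) : ℂ) ≠ 0 := by
    exact_mod_cast (sqrt_one_sub_pos (Complex.UnitDisc.mk a ha)).ne'
  have hbb : b * conj b = 1 := by rw [Complex.mul_conj', hb]; simp
  rw [Complex.UnitDisc.coe_mk] at h
  rw [stepMatrix]
  generalize ((Real.sqrt (1 - ‖a‖ ^ 2) : ℝ) : ℂ) = ρ at *
  rw [smul_mul_smul_comm, ← mul_inv, ← sq, h]
  have h1 : 1 - a * conj a ≠ 0 := by rw [← h]; exact pow_ne_zero 2 h0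
  rw [inv_smul_eq_iff₀ h1]
  ext i j
  fin_cases i <;> fin_cases j <;> simp [Matrix.mul_apply, Fin.sum_univ_two]
  · linear_combination hbb
  · ring
  · ring
  · linear_combination hbb

/-- Moving a coefficient radially makes the relative transfer matrix hyperbolic. -/
theorem exists_radial_perturbation {r : ℝ} (hr0 : 0 < r) (hr1 : r < 1) (a : Complex.UnitDisc)
    (ha : ‖(a : ℂ)‖ ≤ r) {κ : ℝ} (hκ : 0 < κ) :
    ∃ b : Complex.UnitDisc, ‖(b : ℂ)‖ ≤ r ∧ ‖(b : ℂ) - a‖ ≤ κ ∧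
      ∀ w : ℂ, ‖w‖ = 1 → 2 < ‖(stepMatrix b w *
        (((Real.sqrt (1 - ‖(a : ℂ)‖ ^ 2) : ℝ) : ℂ)⁻¹ • !![(a : ℂ), conj w; w, conj (a : ℂ)])).trace‖
    := by
  have key : ∀ (b : Complex.UnitDisc) (s : ℝ), (b : ℂ) ≠ a → conj (b : ℂ) * a = s →
      ∀ w : ℂ, ‖w‖ = 1 → 2 < ‖(stepMatrix b w * (((Real.sqrt (1 - ‖(a : ℂ)‖ ^ 2) : ℝ) : ℂ)⁻¹ •
        !![(a : ℂ), conj w; w, conj (a : ℂ)])).trace‖ := by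
    intro b s hne hs w hw
    have hww : w * conj w = 1 := by rw [Complex.mul_conj', hw]; simp
    have hs' : (b : ℂ) * conj (a : ℂ) = s := by
      have := congrArg conj hs
      simpa using this
    set ρ := Real.sqrt (1 - ‖(a : ℂ)‖ ^ 2) with hρ
    set ρ' := Real.sqrt (1 - ‖(b : ℂ)‖ ^ 2) with hρ'
    have hp : 0 < ρ := sqrt_one_sub_pos a
    have hp' : 0 < ρ' := sqrt_one_sub_pos b
    have htr : (stepMatrix b w * ((ρ : ℂ)⁻¹ • !![(a : ℂ), conj w; w, conj (a : ℂ)])).trace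
        = ((2 * (1 - s) / (ρ' * ρ) : ℝ) : ℂ) := by
      simp only [stepMatrix, ← hρ', Matrix.trace_fin_two, Matrix.mul_apply, Fin.sum_univ_two,
        Matrix.smul_apply, Matrix.of_apply, Matrix.cons_val', Matrix.cons_val_zero,
        Matrix.cons_val_one, Matrix.cons_val_fin_one, smul_eq_mul]
      push_cast
      have : (ρ : ℂ) ≠ 0 := by exact_mod_cast hp.ne'
      have : (ρ' : ℂ) ≠ 0 := by exact_mod_cast hp'.ne'
      field_simp
      linear_combination 2 * hww - hs - hs'
    rw [htr, Complex.norm_real]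
    have hslt : s < 1 := by
      have h1 : ‖conj (b : ℂ) * a‖ < 1 := by
        rw [norm_mul, RCLike.norm_conj]
        nlinarith [a.norm_lt_one, b.norm_lt_one, norm_nonneg (a : ℂ), norm_nonneg (b : ℂ)]
      rw [hs, Complex.norm_real] at h1
      exact (le_abs_self s).trans_lt h1
    have hsq : ‖(a : ℂ) - b‖ ^ 2 = ‖(a : ℂ)‖ ^ 2 + ‖(b : ℂ)‖ ^ 2 - 2 * s := by
      have h2 : ((‖(a : ℂ) - b‖ ^ 2 : ℝ) : ℂ)
          = ((‖(a : ℂ)‖ ^ 2 + ‖(b : ℂ)‖ ^ 2 - 2 * s : ℝ) : ℂ) := by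
        push_cast
        rw [← Complex.mul_conj', ← Complex.mul_conj', ← Complex.mul_conj', map_sub]
        linear_combination -hs - hs'
      exact_mod_cast h2
    have hab : ‖(a : ℂ)‖ ^ 2 * ‖(b : ℂ)‖ ^ 2 = s ^ 2 := by
      have h3 : ‖conj (b : ℂ) * a‖ = |s| := by rw [hs, Complex.norm_real, Real.norm_eq_abs]
      rw [norm_mul, RCLike.norm_conj] at h3
      rw [← sq_abs s, ← h3]
      ring
    have hpos : 0 < ‖(a : ℂ) - b‖ ^ 2 := by
      have : 0 < ‖(a : ℂ) - b‖ := norm_pos_iff.2 (sub_ne_zero.2 hne.symm)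
      positivity
    have hρsq : ρ ^ 2 = 1 - ‖(a : ℂ)‖ ^ 2 :=
      Real.sq_sqrt (by have := a.sq_norm_lt_one; linarith)
    have hρsq' : ρ' ^ 2 = 1 - ‖(b : ℂ)‖ ^ 2 :=
      Real.sq_sqrt (by have := b.sq_norm_lt_one; linarith)
    -- As b̄a = s is real, s² = |a|²|b|², whence (1 - s)² - ρ²ρ'² = |a - b|² > 0.
    have hlt : ρ' * ρ < 1 - s := by
      refine lt_of_pow_lt_pow_left₀ 2 (by linarith) ?_
      rw [mul_pow, hρsq, hρsq']
      nlinarith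
    refine lt_of_lt_of_le ?_ (le_abs_self _)
    rw [lt_div_iff₀ (by positivity)]
    linarith
  -- A nonzero coefficient is shrunk, which keeps it within the bound r; the coefficient 0 must move
  -- outwards, for which r > 0 leaves room.
  by_cases h0 : (a : ℂ) = 0
  · have hm : 0 < min r κ := lt_min hr0 hκ
    have hn : ‖((min r κ : ℝ) : ℂ)‖ = min r κ := by
      rw [Complex.norm_real, Real.norm_eq_abs, abs_of_pos hm]
    refine ⟨Complex.UnitDisc.mk ((min r κ : ℝ) : ℂ) ?_, ?_, ?_, key _ 0 ?_ ?_⟩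
    · rw [hn]; exact (min_le_left _ _).trans_lt hr1
    · rw [Complex.UnitDisc.coe_mk, hn]; exact min_le_left _ _
    · rw [Complex.UnitDisc.coe_mk, h0, sub_zero, hn]; exact min_le_right _ _
    · rw [Complex.UnitDisc.coe_mk, h0]
      exact_mod_cast hm.ne'
    · simp [h0]
  · set t : ℝ := 1 - min κ 1 / 2 with ht
    have hm : 0 < min κ 1 := lt_min hκ one_pos
    have hm1 : min κ 1 ≤ 1 := min_le_right _ _
    have hmκ : min κ 1 ≤ κ := min_le_left _ _
    have ht0 : 0 < t := by linarith
    have ht1 : t < 1 := by linarith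
    have hn : ‖(t : ℂ) * a‖ = t * ‖(a : ℂ)‖ := by
      rw [norm_mul, Complex.norm_real, Real.norm_eq_abs, abs_of_pos ht0]
    have hle : t * ‖(a : ℂ)‖ ≤ r := by nlinarith [norm_nonneg (a : ℂ)]
    refine ⟨Complex.UnitDisc.mk ((t : ℂ) * a) ?_, ?_, ?_, key _ (t * ‖(a : ℂ)‖ ^ 2) ?_ ?_⟩
    · rw [hn]; linarith
    · rw [Complex.UnitDisc.coe_mk, hn]; exact hle
    · rw [Complex.UnitDisc.coe_mk, show (t : ℂ) * a - a = -(((1 - t : ℝ) : ℂ) * a) by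
        push_cast; ring, norm_neg, norm_mul, Complex.norm_real, Real.norm_eq_abs,
        abs_of_pos (by linarith)]
      nlinarith [a.norm_lt_one, norm_nonneg (a : ℂ)]
    · rw [Complex.UnitDisc.coe_mk]
      intro h
      have h1 : ((t : ℂ) - 1) * a = 0 := by linear_combination h
      rcases mul_eq_zero.1 h1 with h2 | h2
      · have : t = 1 := by exact_mod_cast sub_eq_zero.1 h2
        linarith
      · exact h0 h2
    · rw [Complex.UnitDisc.coe_mk, map_mul, Complex.conj_ofReal]
      push_cast
      rw [← Complex.mul_conj']
      ring

end Cocycle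

theorem norm_circle_exp_sub_one_le (θ : ℝ) : ‖(Circle.exp θ : ℂ) - 1‖ ≤ |θ| := by
  have := Real.norm_exp_I_mul_ofReal_sub_one_le (x := θ)
  rw [Circle.coe_exp, mul_comm]
  simpa using this

theorem dvd_natCast_iff_of_lt {P : ℕ} {i : ℕ} (hi : i + 1 < P) : ¬ (P : ℤ) ∣ (0 + (i : ℤ)) + 1 := by
  intro h
  have h2 : P ∣ i + 1 := by
    have : (0 + (i : ℤ)) + 1 = ((i + 1 : ℕ) : ℤ) := by push_cast; ring
    rw [this] at h
    exact_mod_cast h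
  exact absurd (Nat.le_of_dvd (by omega) h2) (by omega)

/-- Every periodic sequence has small periodic perturbations, within the same bound, for which a
prescribed point of the circle is a point of hyperbolicity. -/
theorem exists_hyperbolic_perturbation {q : ℕ} (hq : 0 < q) (hqe : Even q) {r : ℝ} (hr0 : 0 < r)
    (hr1 : r < 1) {α : ℤ → Complex.UnitDisc} {lam : ℤ → Circle} (hα : ∀ n, α (n + q) = α n)
    (hl : ∀ n, lam (n + q) = lam n) (hr : ∀ n, ‖(α n : ℂ)‖ ≤ r) {κ : ℝ} (hκ : 0 < κ)
    (z : Circle) :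
    ∃ (N : ℕ) (β : ℤ → Complex.UnitDisc) (μ : ℤ → Circle), 0 < N ∧
      (∀ n, β (n + (N * q : ℕ)) = β n) ∧ (∀ n, μ (n + (N * q : ℕ)) = μ n) ∧
      (∀ n, ‖(β n : ℂ)‖ ≤ r) ∧ (∀ n, ‖(β n : ℂ) - α n‖ ≤ κ) ∧ (∀ n, ‖(μ n : ℂ) - lam n‖ ≤ κ) ∧
      2 < ‖(cocycle β μ z 0 (N * q)).trace‖ := by
  classical
  have hdet : (cocycle α lam z 0 q).det = 1 := by rw [det_cocycle, hqe.neg_one_pow]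
  obtain ⟨θ, hθ, hcase⟩ := exists_rotation hdet (cocycle_conj 0 q).1 (cocycle_conj 0 q).2
    (half_pos hκ)
  set u := Circle.exp θ with hu
  have hu1 : ‖(u : ℂ) - 1‖ ≤ κ / 2 := (norm_circle_exp_sub_one_le θ).trans hθ
  -- Only the last site of each period is rotated. It is odd because q is even, and being last it
  -- multiplies the monodromy on the left.
  set α₁ : ℤ → Complex.UnitDisc := fun n => if (q : ℤ) ∣ n + 1 then u • α n else α n with hα₁
  set μ₁ : ℤ → Circle := fun n => if (q : ℤ) ∣ n + 1 then u * lam n else lam n with hμ₁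
  have hdvd : ∀ P : ℕ, ∀ n : ℤ, (P : ℤ) ∣ n + P + 1 ↔ (P : ℤ) ∣ n + 1 := fun P n => by
    rw [add_right_comm]; exact dvd_add_self_right
  have hper1 : ∀ n, α₁ (n + q) = α₁ n := fun n => by simp only [hα₁, hdvd, hα]
  have hper1' : ∀ n, μ₁ (n + q) = μ₁ n := fun n => by simp only [hμ₁, hdvd, hl]
  have hr1' : ∀ n, ‖(α₁ n : ℂ)‖ ≤ r := fun n => by
    simp only [hα₁]
    split_ifs
    · rw [Complex.UnitDisc.coe_circle_smul, norm_mul, Circle.norm_coe, one_mul]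
      exact hr n
    · exact hr n
  have hclose : ∀ n, ‖(α₁ n : ℂ) - α n‖ ≤ κ / 2 := fun n => by
    simp only [hα₁]
    split_ifs
    · rw [Complex.UnitDisc.coe_circle_smul, show (u : ℂ) * α n - α n = (u - 1) * α n by ring,
        norm_mul]
      nlinarith [norm_nonneg ((u : ℂ) - 1), (α n).norm_lt_one]
    · rw [sub_self, norm_zero]; positivity
  have hclose' : ∀ n, ‖(μ₁ n : ℂ) - lam n‖ ≤ κ / 2 := fun n => by
    simp only [hμ₁]
    split_ifs
    · rw [Circle.coe_mul, show (u : ℂ) * lam n - lam n = (u - 1) * lam n by ring,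
        norm_mul, Circle.norm_coe, mul_one]
      exact hu1
    · rw [sub_self, norm_zero]; positivity
  have hodd : ∀ P : ℕ, Even P → 0 < P → ¬ Even (0 + ((P - 1 : ℕ) : ℤ)) := fun P hP hP0 => by
    obtain ⟨m, rfl⟩ := hP
    rw [zero_add, Int.even_coe_nat]
    rw [Nat.not_even_iff_odd]
    exact ⟨m - 1, by omega⟩
  have hlast : ∀ P : ℕ, 0 < P → (0 + ((P - 1 : ℕ) : ℤ)) + 1 = P := fun P hP => by
    push_cast [Nat.cast_sub hP]; ring
  have hC1 : cocycle α₁ μ₁ z 0 q = !![conj (u : ℂ), 0; 0, (u : ℂ)] * cocycle α lam z 0 q := by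
    obtain ⟨m, rfl⟩ : ∃ m, q = m + 1 := ⟨q - 1, by omega⟩
    have hm := hodd (m + 1) hqe hq
    have hm' := hlast (m + 1) hq
    rw [Nat.add_sub_cancel] at hm hm'
    rw [cocycle, cocycle, ← mul_assoc]
    congr 1
    · rw [transfer, transfer, if_neg hm, if_neg hm, ← stepMatrix_rotate]
      have hd : ((m + 1 : ℕ) : ℤ) ∣ (0 + (m : ℤ)) + 1 := by rw [hm']
      simp only [hα₁, hμ₁, if_pos hd, Complex.UnitDisc.coe_circle_smul, Circle.coe_mul]
    · refine cocycle_congr (fun i hi => ?_) (fun i hi => ?_)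
      · simp only [hα₁]
        exact if_neg (dvd_natCast_iff_of_lt (by omega))
      · simp only [hμ₁]
        exact if_neg (dvd_natCast_iff_of_lt (by omega))
  rw [← hC1] at hcase
  rcases hcase with hcase | ⟨N, hN, hcase⟩
  · refine ⟨1, α₁, μ₁, one_pos, ?_, ?_, hr1', fun n => ?_, fun n => ?_, ?_⟩
    · simpa using hper1
    · simpa using hper1'
    · linarith [hclose n]
    · linarith [hclose' n]
    · simpa using hcase
  have hNq : 0 < N * q := Nat.mul_pos hN hq
  have hNqe : Even (N * q) := hqe.mul_left N
  set a := α₁ (0 + ((N * q - 1 : ℕ) : ℤ)) with ha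
  obtain ⟨b, hbr, hba, hb⟩ := exists_radial_perturbation hr0 hr1 a (hr1' _) (half_pos hκ)
  -- In the finite-order case the period becomes Nq, and again only its last coefficient is altered,
  -- from `a` to `b`.
  set β : ℤ → Complex.UnitDisc := fun n => if ((N * q : ℕ) : ℤ) ∣ n + 1 then b else α₁ n with hβ
  have hmulper : ∀ {γ : Type} {f : ℤ → γ}, (∀ n, f (n + q) = f n) →
      ∀ n, f (n + (N * q : ℕ)) = f n := fun h n => by
    push_cast
    exact apply_add_mul_eq h n N
  refine ⟨N, β, μ₁, hN, fun n => ?_, hmulper hper1', fun n => ?_, fun n => ?_, fun n => ?_, ?_⟩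
  · simp only [hβ, hdvd, hmulper hper1]
  · simp only [hβ]
    split_ifs
    · exact hbr
    · exact hr1' n
  · simp only [hβ]
    split_ifs with h
    · have han : α₁ n = a := by
        obtain ⟨k, hk⟩ := h
        have h2 := hlast (N * q) hNq
        rw [ha, ← apply_add_mul_eq (hmulper hper1) (0 + ((N * q - 1 : ℕ) : ℤ)) (k - 1)]
        congr 1
        linear_combination hk + -h2
      have h1 := hclose n
      rw [han] at h1
      have := norm_sub_le_norm_sub_add_norm_sub (b : ℂ) a (α n)
      linarith
    · linarith [hclose n]
  · linarith [hclose' n]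
  · obtain ⟨m, hm⟩ : ∃ m, N * q = m + 1 := ⟨N * q - 1, by omega⟩
    have hmo := hodd (N * q) hNqe hNq
    have hml := hlast (N * q) hNq
    have hpow : cocycle α₁ μ₁ z 0 (N * q) = 1 ∨ cocycle α₁ μ₁ z 0 (N * q) = -1 := by
      rw [cocycle_mul_period hqe hper1 hper1']
      exact hcase
    have ha' : a = α₁ (0 + (m : ℤ)) := by rw [ha, hm, Nat.add_sub_cancel]
    rw [hm, Nat.add_sub_cancel] at hmo hml
    rw [hm] at hpow ⊢
    rw [cocycle, transfer, if_neg hmo] at hpow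
    rw [cocycle, transfer, if_neg hmo]
    have hβm : β (0 + (m : ℤ)) = b := by
      simp only [hβ]
      rw [if_pos]
      rw [hm, hml]
    have hcc : cocycle β μ₁ z 0 m = cocycle α₁ μ₁ z 0 m := by
      refine cocycle_congr (fun i hi => ?_) (fun i hi => rfl)
      simp only [hβ]
      exact if_neg (dvd_natCast_iff_of_lt (by omega))
    rw [hβm, hcc]
    rw [← ha'] at hpow
    set w := μ₁ (0 + (m : ℤ))
    have hinv := stepMatrix_left_inv a.norm_lt_one (Circle.norm_coe w)
    have hbw := hb w (Circle.norm_coe w)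
    set A' := ((Real.sqrt (1 - ‖(a : ℂ)‖ ^ 2) : ℝ) : ℂ)⁻¹ •
      !![(a : ℂ), conj (w : ℂ); (w : ℂ), conj (a : ℂ)]
    set C := cocycle α₁ μ₁ z 0 m
    -- Since stepMatrix a w * C = ±1, the new monodromy is ± stepMatrix b w * (stepMatrix a w)⁻¹,
    -- which is hyperbolic by the choice of `b`.
    have hCA : C = A' * (stepMatrix a w * C) := by rw [← mul_assoc, hinv, one_mul]
    rcases hpow with h | h
    · rw [h, mul_one] at hCA
      rw [hCA]
      exact hbw
    · rw [h, mul_neg, mul_one] at hCA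
      rw [hCA, mul_neg, Matrix.trace_neg, norm_neg]
      exact hbw

/-! ### Compactness in the spectral parameter. -/

theorem continuous_transfer (α : ℤ → Complex.UnitDisc) (lam : ℤ → Circle) (n : ℤ) :
    Continuous fun z : Circle => transfer α lam z n := by
  refine continuous_matrix fun i j => ?_
  unfold transfer
  split_ifs
  · fin_cases i <;> fin_cases j <;> simp [stepMatrix] <;> fun_prop
  · exact continuous_const

theorem continuous_cocycle (α : ℤ → Complex.UnitDisc) (lam : ℤ → Circle) (a : ℤ) (n : ℕ) :
    Continuous fun z : Circle => cocycle α lam z a n := by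
  induction n with
  | zero => exact continuous_const
  | succ n ih => exact (continuous_transfer α lam _).mul ih

/-- Finitely many small perturbations suffice for uniform hyperbolicity on the whole circle. -/
theorem exists_finite_hyperbolic_family {q : ℕ} (hq : 0 < q) (hqe : Even q) {r : ℝ} (hr0 : 0 < r)
    (hr1 : r < 1) {α : ℤ → Complex.UnitDisc} {lam : ℤ → Circle} (hα : ∀ n, α (n + q) = α n)
    (hl : ∀ n, lam (n + q) = lam n) (hr : ∀ n, ‖(α n : ℂ)‖ ≤ r) {κ : ℝ} (hκ : 0 < κ) :
    ∃ (m : ℕ) (N : Fin m → ℕ) (β : Fin m → ℤ → Complex.UnitDisc) (μ : Fin m → ℤ → Circle) (e : ℝ),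
      0 < m ∧ 0 < e ∧ (∀ j, 0 < N j) ∧ (∀ j n, β j (n + (N j * q : ℕ)) = β j n) ∧
      (∀ j n, μ j (n + (N j * q : ℕ)) = μ j n) ∧ (∀ j n, ‖(β j n : ℂ)‖ ≤ r) ∧
      (∀ j n, ‖(β j n : ℂ) - α n‖ ≤ κ) ∧ (∀ j n, ‖(μ j n : ℂ) - lam n‖ ≤ κ) ∧
      ∀ z : Circle, ∃ j, 2 + e ≤ ‖(cocycle (β j) (μ j) z 0 (N j * q)).trace‖ := by
  choose N β μ hN hβ hμ hβr hβα hμl htr using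
    fun z => exists_hyperbolic_perturbation hq hqe hr0 hr1 hα hl hr hκ z
  set g : Circle → Circle → ℝ := fun w z => ‖(cocycle (β w) (μ w) z 0 (N w * q)).trace‖ with hg
  have hgc : ∀ w, Continuous (g w) := fun w =>
    (continuous_cocycle (β w) (μ w) 0 (N w * q)).matrix_trace.norm
  -- Half of the excess over 2, so that the strict inequality survives near `w`; the minimum over a
  -- finite subcover is the uniform margin.
  set e : Circle → ℝ := fun w => (g w w - 2) / 2 with he
  have he0 : ∀ w, 0 < e w := fun w => by
    have := htr w
    simp only [he, hg]
    linarith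
  obtain ⟨t, ht⟩ := CompactSpace.elim_nhds_subcover (fun w : Circle => {z | 2 + e w < g w z})
    (fun w => (isOpen_lt continuous_const (hgc w)).mem_nhds (by
      have := he0 w
      simp only [he, Set.mem_ofPred_eq] at this ⊢
      linarith))
  have hcov : ∀ z : Circle, ∃ w ∈ t, 2 + e w < g w z := fun z => by
    have : z ∈ (⊤ : Set Circle) := trivial
    rw [← ht] at this
    simpa using this
  have htne : t.Nonempty := by
    obtain ⟨w, hw, _⟩ := hcov 1
    exact ⟨w, hw⟩
  obtain ⟨w₀, hw₀, hmin⟩ := t.exists_min_image e htne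
  let f : Fin t.card → Circle := fun j => (t.equivFin.symm j : Circle)
  refine ⟨t.card, fun j => N (f j), fun j => β (f j), fun j => μ (f j), e w₀, htne.card_pos,
    he0 _, fun j => hN _, fun j => hβ _, fun j => hμ _, fun j => hβr _, fun j => hβα _,
    fun j => hμl _, fun z => ?_⟩
  obtain ⟨w, hw, hwz⟩ := hcov z
  refine ⟨t.equivFin ⟨w, hw⟩, ?_⟩
  have hf : f (t.equivFin ⟨w, hw⟩) = w := by simp [f]
  have := hmin w hw
  change 2 + e w₀ ≤ g (f (t.equivFin ⟨w, hw⟩)) z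
  rw [hf]
  linarith

/-! ### Arc length of covers and the exponential bound. -/

theorem norm_exp_mul_I_sub (s t : ℝ) :
    ‖Complex.exp (s * Complex.I) - Complex.exp (t * Complex.I)‖ = 2 * |Real.sin ((s - t) / 2)| := by
  have h := Complex.norm_exp_I_mul_ofReal_sub_one (s - t)
  have e : Complex.exp (s * Complex.I) - Complex.exp (t * Complex.I)
      = Complex.exp (t * Complex.I) * (Complex.exp (Complex.I * ((s - t : ℝ) : ℂ)) - 1) := by
    rw [mul_sub, ← Complex.exp_add, mul_one]
    congr 2
    push_cast
    ring
  rw [e, norm_mul, Complex.norm_exp_ofReal_mul_I, one_mul, h, norm_mul, Real.norm_eq_abs,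
    Real.norm_eq_abs, abs_two]

/-- Arc length of the part of the unit circle inside a ball. -/
theorem arcLength_ball_le (μ : ℂ) (τ : ℝ) :
    arcLength (Metric.ball μ τ) ≤ ENNReal.ofReal (6 * Real.pi * τ) := by
  have hmeas : Measurable fun t : ℝ => Complex.exp (t * Complex.I) := by fun_prop
  rw [arcLength, Measure.map_apply hmeas measurableSet_ball,
    Measure.restrict_apply (hmeas measurableSet_ball)]
  set S := (fun t : ℝ => Complex.exp (t * Complex.I)) ⁻¹' Metric.ball μ τ
    ∩ Set.Ico 0 (2 * Real.pi) with hS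
  rcases S.eq_empty_or_nonempty with h | ⟨t₀, ht₀, ht₀'⟩
  · rw [h, measure_empty]; exact zero_le
  have hτ : 0 < τ := dist_nonneg.trans_lt (Metric.mem_ball.1 ht₀)
  have hpi := Real.pi_pos
  have hw : 0 ≤ Real.pi * τ := by positivity
  -- By Jordan's inequality sin v ≥ 2v/π, any two parameters in `S` differ by less than πτ modulo
  -- 2π. The three intervals of length 2πτ account for the shifts by 0 and ±2π.
  have hsub : S ⊆ (Set.Icc (t₀ - Real.pi * τ) (t₀ + Real.pi * τ)
      ∪ Set.Icc (t₀ + 2 * Real.pi - Real.pi * τ) (t₀ + 2 * Real.pi + Real.pi * τ))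
      ∪ Set.Icc (t₀ - 2 * Real.pi - Real.pi * τ) (t₀ - 2 * Real.pi + Real.pi * τ) := by
    rintro t ⟨ht, ht'⟩
    have hd : 2 * |Real.sin ((t - t₀) / 2)| < 2 * τ := by
      rw [← norm_exp_mul_I_sub]
      have h1 : dist (Complex.exp (t * Complex.I)) μ < τ := ht
      have h2 : dist (Complex.exp (t₀ * Complex.I)) μ < τ := ht₀
      rw [← dist_eq_norm]
      have := dist_triangle_right (Complex.exp (t * Complex.I)) (Complex.exp (t₀ * Complex.I)) μ
      linarith
    have hsin : ∀ u, 0 ≤ u → u < Real.pi → Real.sin u < τ →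
        u < Real.pi * τ / 2 ∨ Real.pi - u < Real.pi * τ / 2 := by
      intro u hu hu' hs
      have hj : ∀ v, 0 ≤ v → v ≤ Real.pi / 2 → Real.sin v < τ → v < Real.pi * τ / 2 := by
        intro v hv hv' hvs
        have h1 := Real.mul_le_sin hv hv'
        have h2 : 2 / Real.pi * v < τ := h1.trans_lt hvs
        rw [div_mul_eq_mul_div, div_lt_iff₀ hpi] at h2
        linarith
      rcases le_total u (Real.pi / 2) with h | h
      · exact Or.inl (hj u hu h hs)
      · exact Or.inr (hj _ (by linarith) (by linarith) (by rwa [Real.sin_pi_sub]))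
    have hlt : |Real.sin ((t - t₀) / 2)| < τ := by linarith
    obtain ⟨h0, h2⟩ := ht'
    obtain ⟨h0', h2'⟩ := ht₀'
    have hτ' := abs_lt.1 hlt
    rcases le_total t₀ t with hle | hle
    · rcases hsin ((t - t₀) / 2) (by linarith) (by linarith) hτ'.2 with h | h
      · exact Or.inl (Or.inl ⟨by linarith, by linarith⟩)
      · exact Or.inl (Or.inr ⟨by linarith, by linarith⟩)
    · have hneg : Real.sin ((t₀ - t) / 2) < τ := by
        rw [show (t₀ - t) / 2 = -((t - t₀) / 2) by ring, Real.sin_neg]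
        linarith
      rcases hsin ((t₀ - t) / 2) (by linarith) (by linarith) hneg with h | h
      · exact Or.inl (Or.inl ⟨by linarith, by linarith⟩)
      · exact Or.inr ⟨by linarith, by linarith⟩
  refine (measure_mono hsub).trans ((measure_union_le _ _).trans
    ((add_le_add (measure_union_le _ _) le_rfl).trans (le_of_eq ?_)))
  simp only [Real.volume_Icc]
  rw [← ENNReal.ofReal_add (by linarith) (by linarith), ← ENNReal.ofReal_add (by linarith)
    (by linarith)]
  congr 1
  ring

theorem arcLength_le_of_finite_cover {ι : Type*} [Fintype ι] {F : ι → Finset ℂ} {p : ℕ} {τ : ℝ}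
    (hF : ∀ j, (F j).card ≤ p) {S : Set ℂ} (hS : ∀ z ∈ S, ∃ j, ∃ μ ∈ F j, ‖z - μ‖ < τ) :
    arcLength S ≤ ENNReal.ofReal (Fintype.card ι * p * (6 * Real.pi * τ)) := by
  have hsub : S ⊆ ⋃ j ∈ (Finset.univ : Finset ι), ⋃ μ ∈ F j, Metric.ball μ τ := by
    intro z hz
    obtain ⟨j, μ, hμ, h⟩ := hS z hz
    simp only [Set.mem_iUnion]
    exact ⟨j, Finset.mem_univ _, μ, hμ, by rwa [Metric.mem_ball, dist_eq_norm]⟩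
  refine (measure_mono hsub).trans ((measure_biUnion_finset_le _ _).trans ?_)
  calc ∑ j, arcLength (⋃ μ ∈ F j, Metric.ball μ τ)
      ≤ ∑ j : ι, (p : ENNReal) * ENNReal.ofReal (6 * Real.pi * τ) := by
        refine Finset.sum_le_sum fun j _ => (measure_biUnion_finset_le _ _).trans ?_
        refine (Finset.sum_le_card_nsmul _ _ _ fun μ _ => arcLength_ball_le μ τ).trans ?_
        rw [nsmul_eq_mul]
        gcongr
        exact hF j
    _ = _ := by
        generalize 6 * Real.pi * τ = x
        rw [Finset.sum_const, nsmul_eq_mul, Finset.card_univ, mul_assoc (Fintype.card ι : ℝ),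
          ENNReal.ofReal_mul (by positivity), ENNReal.ofReal_mul (by positivity),
          ENNReal.ofReal_natCast, ENNReal.ofReal_natCast]

/-- With γ = -log κ, the power is at most e^γ e^{-γn/R}, the factor e^γ paying for the floor. Half
of the rate γ/R absorbs the linear factor via e^x ≥ x²/2, and the other half is cq. -/
theorem exists_exp_bound {A κ : ℝ} (hA : 0 < A) (hκ0 : 0 < κ) (hκ1 : κ < 1) {R q : ℕ}
    (hR : 0 < R) (hq : 0 < q) : ∃ (c : ℝ) (N₀ : ℕ), 0 < c ∧ 0 < N₀ ∧ ∀ n : ℕ, N₀ ≤ n →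
      A * n * κ ^ (n / R) ≤ Real.exp (-(c * n * q)) := by
  set γ := -Real.log κ with hγ
  have hγ0 : 0 < γ := neg_pos.2 (Real.log_neg hκ0 hκ1)
  have hR' : (0 : ℝ) < R := by exact_mod_cast hR
  have hq' : (0 : ℝ) < q := by exact_mod_cast hq
  set b := γ / (2 * R) with hb
  have hb0 : 0 < b := by positivity
  obtain ⟨N₀, hN₀⟩ := exists_nat_gt (2 * (A * Real.exp γ) / b ^ 2)
  refine ⟨b / q, N₀ + 1, by positivity, by omega, fun n hn => ?_⟩
  have hnN : 2 * (A * Real.exp γ) / b ^ 2 < n := hN₀.trans_le (by exact_mod_cast by omega)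
  have hn0 : (0 : ℝ) < n := by exact_mod_cast (by omega : 0 < n)
  rw [div_lt_iff₀ (by positivity)] at hnN
  have hpow : κ ^ (n / R) ≤ Real.exp γ * Real.exp (-(2 * (b * n))) := by
    have h1 : κ ^ (n / R) = Real.exp (-(γ * (n / R : ℕ))) := by
      rw [hγ, neg_mul, neg_neg, mul_comm, Real.exp_nat_mul, Real.exp_log hκ0]
    rw [h1, ← Real.exp_add]
    refine Real.exp_le_exp.2 ?_
    have h2 : (n : ℝ) / R < (n / R : ℕ) + 1 := by
      rw [div_lt_iff₀ hR']
      have := Nat.lt_div_mul_add (a := n) hR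
      have h3 : n < (n / R + 1) * R := by rw [add_mul, one_mul]; exact this
      exact_mod_cast h3
    have h4 : 2 * (b * n) = γ * (n / R) := by
      rw [hb]
      field_simp
    rw [h4]
    nlinarith
  have hexp : A * n * Real.exp γ ≤ Real.exp (b * n) := by
    have := Real.quadratic_le_exp_of_nonneg (x := b * n) (by positivity)
    have h5 : 0 < b * n := by positivity
    nlinarith
  have he : b / q * n * q = b * n := by field_simp
  rw [he]
  calc A * n * κ ^ (n / R) ≤ A * n * (Real.exp γ * Real.exp (-(2 * (b * n)))) := by gcongr
    _ = (A * n * Real.exp γ) * Real.exp (-(2 * (b * n))) := by ring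
    _ ≤ Real.exp (b * n) * Real.exp (-(2 * (b * n))) := by gcongr
    _ = Real.exp (-(b * n)) := by rw [← Real.exp_add]; congr 1; ring

/-! ### Concatenating the perturbations in one cell. -/

/-- Concatenation: on the cell `[0, p)` use the sequence `β j` on `[j s, (j + 1) s)` for `j < m` and
the sequence `α` afterwards, and continue `p`-periodically. -/
def concat {X : Type*} (p s m : ℕ) (α : ℤ → X) (β : Fin m → ℤ → X) (n : ℤ) : X :=
  if h : (n % p).toNat / s < m then β ⟨(n % p).toNat / s, h⟩ (n % p) else α (n % p)

theorem concat_add_period {X : Type*} (p s m : ℕ) (α : ℤ → X) (β : Fin m → ℤ → X) (n : ℤ) :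
    concat p s m α β (n + p) = concat p s m α β n := by
  simp only [concat, Int.add_emod_right]

theorem concat_cases {X : Type*} (p s m : ℕ) (α : ℤ → X) (β : Fin m → ℤ → X) (n : ℤ)
    {C : X → Prop} (hα : C (α (n % p))) (hβ : ∀ j, C (β j (n % p))) :
    C (concat p s m α β n) := by
  unfold concat
  split_ifs
  · exact hβ _
  · exact hα

theorem concat_eq {X : Type*} {p s m : ℕ} (α : ℤ → X) (β : Fin m → ℤ → X) (j : Fin m) {i : ℕ}
    (hi : i < p) (h1 : j * s ≤ i) (h2 : i < (j + 1) * s) : concat p s m α β i = β j i := by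
  have hmod : ((i : ℤ) % (p : ℤ)) = i := Int.emod_eq_of_lt (by omega) (by exact_mod_cast hi)
  have hs : 0 < s := by
    rcases Nat.eq_zero_or_pos s with h | h
    · subst h; simp at h2
    · exact h
  have hdiv : i / s = j := Nat.div_eq_of_lt_le h1 h2
  have hj : i / s < m := by rw [hdiv]; exact j.2
  have he : (⟨i / s, hj⟩ : Fin m) = j := Fin.ext hdiv
  simp only [concat, hmod, Int.toNat_natCast]
  rw [dif_pos hj, he]

theorem inv_sqrt_le {r : ℝ} (hr1 : r < 1) {a : Complex.UnitDisc} (ha : ‖(a : ℂ)‖ ≤ r) :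
    (Real.sqrt (1 - ‖(a : ℂ)‖ ^ 2))⁻¹ ≤ (Real.sqrt (1 - r ^ 2))⁻¹ := by
  have h0 := norm_nonneg (a : ℂ)
  refine inv_anti₀ (Real.sqrt_pos.2 (by nlinarith)) (Real.sqrt_le_sqrt ?_)
  nlinarith

/-- Along a stretch the cocycle of the concatenation is that of the corresponding sequence. -/
theorem cocycle_concat {p s m P : ℕ} (hP : Even P) {α : ℤ → Complex.UnitDisc} {lam : ℤ → Circle}
    {β : Fin m → ℤ → Complex.UnitDisc} {μ : Fin m → ℤ → Circle} (j : Fin m)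
    (hβ : ∀ n, β j (n + P) = β j n) (hμ : ∀ n, μ j (n + P) = μ j n) (hPs : P ∣ s)
    (hms : m * s ≤ p) (z : Circle) {l : ℕ} (hl : (l + 1) * P ≤ s) :
    cocycle (concat p s m α β) (concat p s m lam μ) z (((j * s : ℕ) : ℤ) + (l * P : ℕ)) P
      = cocycle (β j) (μ j) z 0 P := by
  obtain ⟨k, rfl⟩ := hPs
  have hj1 : ((j : ℕ) + 1) * (P * k) ≤ m * (P * k) := Nat.mul_le_mul_right _ j.2
  have hidx : ∀ i, i < P → (((j * (P * k) : ℕ) : ℤ) + (l * P : ℕ)) + i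
      = ((j * (P * k) + l * P + i : ℕ) : ℤ) := fun i _ => by push_cast; ring
  have hup : ∀ i, i < P → j * (P * k) + l * P + i < (j + 1) * (P * k) := fun i hi => by
    have : l * P + P ≤ P * k := by rw [← Nat.succ_mul]; exact hl
    rw [add_mul, one_mul]
    omega
  rw [cocycle_congr (β := β j) (μ := μ j)]
  -- `concat` does not re-index `β j` at the start of its stretch; as `P` divides `s`, every period
  -- in the stretch starts at a multiple of `P`, so the cocycle agrees with the one at 0.
  · have h := cocycle_periodic (z := z) hP hβ hμ (j * k + l) 0 P
    rw [← h]
    congr 1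
    push_cast
    ring
  · intro i hi
    rw [hidx i hi]
    exact concat_eq _ _ j (by have := hup i hi; omega) (by omega) (hup i hi)
  · intro i hi
    rw [hidx i hi]
    exact concat_eq _ _ j (by have := hup i hi; omega) (by omega) (hup i hi)

end PCMV

end

/-! ### Assembly of the theorem. -/

theorem lemma5p3 (q : ℕ) (hq : 0 < q) (hq_even : Even q) (r : ℝ) (hr0 : 0 < r) (hr1 : r < 1)
    (E : PCMV.Ell2 →L[ℂ] PCMV.Ell2) (hE : E ∈ PCMV.periodicPCMV q r) (δ : ℝ) (hδ : 0 < δ) :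
    ∃ (c : ℝ) (N₀ : ℕ), 0 < c ∧ 0 < N₀ ∧
      ∀ n : ℕ, N₀ ≤ n → ∃ E' ∈ PCMV.periodicPCMV (n * q) r,
        ‖E - E'‖ < δ ∧
        PCMV.arcLength (spectrum ℂ E') ≤ ENNReal.ofReal (Real.exp (-(c * n * q))) := by
  obtain ⟨α, lam, hα, hl, hr, rfl⟩ := hE
  obtain ⟨ε, hε, hclose⟩ := PCMV.exists_pos_norm_pcmv_sub_lt hδ
  obtain ⟨m, N, β, μ, e, hm, he, hN, hβ, hμ, hβr, hβα, hμl, hhyp⟩ :=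
    PCMV.exists_finite_hyperbolic_family hq hq_even hr0 hr1 hα hl hr hε
  -- A common multiple of the `N j`, so that one stretch length suits all the periods.
  set Q := ∏ j, N j with hQ
  have hQ0 : 0 < Q := Finset.prod_pos fun j _ => hN j
  have hNQ : ∀ j, N j ∣ Q := fun j => Finset.dvd_prod_of_mem N (Finset.mem_univ j)
  set K := (Real.sqrt (1 - r ^ 2))⁻¹ with hK
  have hsr : 0 < Real.sqrt (1 - r ^ 2) := Real.sqrt_pos.2 (by nlinarith)
  have hK1 : 1 ≤ K := (one_le_inv₀ hsr).2 (Real.sqrt_le_one.2 (by nlinarith))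
  have hK0 : 0 < K := by linarith
  set κ := 2 / (2 + e) with hκ
  have hκ0 : 0 < κ := by positivity
  have hκ1 : κ < 1 := by rw [hκ, div_lt_one (by positivity)]; linarith
  -- With d = n / R and s = 2dQq, each stretch contains at least 2d periods `N j * q`, and the m
  -- stretches fit in a cell because ms = dRq ≤ nq.
  set R := 2 * Q * m with hR
  have hR0 : 0 < R := by positivity
  have hm' : (0 : ℝ) < m := by exact_mod_cast hm
  have hq' : (0 : ℝ) < q := by exact_mod_cast hq
  obtain ⟨c, N₀, hc, hN₀, hbound⟩ := PCMV.exists_exp_bound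
    -- m finite sets of at most nq points, each point with a disc of radius 8Kκ ^ d and arc length
    -- at most 6π times that radius.
    (A := m * q * (6 * Real.pi * (8 * K))) (by have := Real.pi_pos; positivity) hκ0 hκ1 hR0 hq
  refine ⟨c, max N₀ R, hc, lt_max_of_lt_left hN₀, fun n hn => ?_⟩
  have hnN : N₀ ≤ n := (le_max_left _ _).trans hn
  have hnR : R ≤ n := (le_max_right _ _).trans hn
  have hn0 : 0 < n := hR0.trans_le hnR
  set d := n / R with hd
  have hd0 : 0 < d := Nat.div_pos hnR hR0
  set s := d * (2 * Q) * q with hs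
  have hms : m * s ≤ n * q := by
    have h1 : d * R ≤ n := Nat.div_mul_le_self n R
    calc m * s = d * R * q := by rw [hs, hR]; ring
      _ ≤ n * q := Nat.mul_le_mul_right q h1
  have : NeZero (n * q) := ⟨(Nat.mul_pos hn0 hq).ne'⟩
  have hpe : Even (n * q) := hq_even.mul_left n
  have hmod : ∀ {X : Type} {f : ℤ → X}, (∀ k, f (k + q) = f k) →
      ∀ k : ℤ, f (k % (n * q : ℕ)) = f k := by
    intro X f hf k
    have h1 := PCMV.apply_add_mul_eq hf (k % (n * q : ℕ)) (n * (k / (n * q : ℕ)))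
    rw [← h1]
    congr 1
    have h2 := Int.emod_add_mul_ediv k (n * q : ℕ)
    push_cast at h2 ⊢
    linarith
  set α' := PCMV.concat (n * q) s m α β with hα'
  set lam' := PCMV.concat (n * q) s m lam μ with hlam'
  have hα'p : ∀ k, α' (k + (n * q : ℕ)) = α' k := PCMV.concat_add_period _ _ _ _ _
  have hlam'p : ∀ k, lam' (k + (n * q : ℕ)) = lam' k := PCMV.concat_add_period _ _ _ _ _
  have hα'r : ∀ k, ‖(α' k : ℂ)‖ ≤ r := fun k =>
    PCMV.concat_cases (n * q) s m α β k (C := fun x : Complex.UnitDisc => ‖(x : ℂ)‖ ≤ r) (hr _)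
      fun j => hβr j _
  refine ⟨PCMV.pcmv α' lam', ⟨α', lam', hα'p, hlam'p, hα'r, rfl⟩, ?_, ?_⟩
  · refine hclose _ _ _ _ (fun k => ?_) (fun k => ?_)
    · refine PCMV.concat_cases (n * q) s m α β k
        (C := fun x : Complex.UnitDisc => ‖(α k : ℂ) - x‖ ≤ ε) ?_ fun j => ?_
      · rw [hmod hα, sub_self, norm_zero]
        exact hε.le
      · rw [← hmod hα k, norm_sub_rev]
        exact hβα j _
    · refine PCMV.concat_cases (n * q) s m lam μ k
        (C := fun x : Circle => ‖(lam k : ℂ) - x‖ ≤ ε) ?_ fun j => ?_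
      · rw [hmod hl, sub_self, norm_zero]
        exact hε.le
      · rw [← hmod hl k, norm_sub_rev]
        exact hμl j _
  · have hse : Even s := hq_even.mul_left _
    choose F hFcard hF using fun j : Fin m =>
      PCMV.exists_finset_near_of_hyperbolic (K := K) hpe hα'p hlam'p
        (fun k => PCMV.inv_sqrt_le hr1 (hα'r k)) hK1 (a := ((j * s : ℕ) : ℤ))
        (by exact_mod_cast hse.mul_left (j : ℕ)) (hq_even.mul_left (N j)) hd0 he
    have hcover : ∀ z ∈ spectrum ℂ (PCMV.pcmv α' lam'), ∃ j, ∃ ν ∈ F j,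
        ‖z - ν‖ < 8 * K * κ ^ d := by
      intro z hz
      have hz1 : ‖z‖ = 1 := spectrum.norm_eq_one_of_unitary (PCMV.pcmv_mem_unitary α' lam') hz
      let w : Circle := ⟨z, mem_sphere_zero_iff_norm.2 hz1⟩
      obtain ⟨j, hj⟩ := hhyp w
      refine ⟨j, hF j w hz ⟨_, fun l hl' => ?_, hj⟩⟩
      have hNle : N j ≤ Q := Nat.le_of_dvd hQ0 (hNQ j)
      refine PCMV.cocycle_concat (hq_even.mul_left (N j)) j (hβ j) (hμ j) ?_ hms w ?_
      · exact Nat.mul_dvd_mul ((hNQ j).trans ⟨d * 2, by ring⟩) dvd_rfl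
      · calc (l + 1) * (N j * q) ≤ (2 * d) * (Q * q) :=
            Nat.mul_le_mul (by omega) (Nat.mul_le_mul_right q hNle)
          _ = s := by rw [hs]; ring
    refine (PCMV.arcLength_le_of_finite_cover hFcard hcover).trans (ENNReal.ofReal_le_ofReal ?_)
    refine le_trans (le_of_eq ?_) (hbound n hnN)
    rw [Fintype.card_fin]
    push_cast
    ring
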